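/- Let $F$ be a free group of finite rank with a basis $\mathfrak B$. A free factor system of $F$ is a finite collection $\mathcal A=\{[A_1],\dots,[A_k]\}$ of conjugacy classes of non-trivial subgroups such that, for suitable representatives, $F=A_1*\cdots*A_k*F_N$ with $F_N$ free of rank $N$; put $\zeta(\mathcal A)=k+N$. It is non-trivial if it is neither $\emptyset$ nor $\{[F]\}$. Write $\mathcal A\sqsubset\mathcal D$ if every $A_i$ is, up to conjugation, contained in some factor of $\mathcal D$. A conjugacy class of $F$ is contained in $\mathcal D$ if it meets a factor of $\mathcal D$; let $[F\setminus\mathcal A]$ be the set of conjugacy classes not contained in $\mathcal A$. A class $\alpha\in[F\setminus\mathcal A]$ is $\mathcal A$-separable if it is contained in a non-trivial free factor system $\mathcal D$ with $\mathcal A\sqsubset\mathcal D$. Let $\partial^2F$ be the space of unoriented bi-infinite geodesics in the Cayley graph of $F$ with respect to $\mathfrak B$, with the topology generated by the sets $C(\gamma)$ of geodesics crossing a given finite path $\gamma$. Let $\partial^2\mathcal A=\bigcup_i\partial^2A_i$, where $\partial^2A_i$ is the closure of the set of all $F$-translates of axes of non-trivial elements of $A_i$, and let $\mathbf Y=\partial^2F\setminus\partial^2\mathcal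 A$ with the subspace topology. A relative current is a non-negative, finitely additive, $F$-invariant real-valued function on the compact open subsets of $\mathbf Y$; the space $\mathcal{RC}(\mathcal A)$ of relative currents has the topology of pointwise convergence on compact open sets, and $\mathbb P\mathcal{RC}(\mathcal A)$ is the quotient of $\mathcal{RC}(\mathcal A)\setminus\{0\}$ by positive scaling, with the quotient topology. For a conjugacy class $\alpha$ of an element $a\neq1$, the rational current $\eta_\alpha$ assigns to $C$ the number of cosets $g\langle a\rangle$ for which $g$ maps the axis of $a$ into $C$ (for $\alpha$ not a proper power, the number of lifts of $\alpha$ lying in $C$). Lemma. Let $\mathcal A$ be a non-trivial free factor system of $F$ with $\zeta(\mathcal A)\ge3$, and let $$\mathcal{MRC}(\mathcal A)=\overline{\{[\eta_v]\in\mathbb P\mathcal{RC}(\mathcal A) : v\in[F\setminus\mathcal A]\text{ is }\mathcal A\text{-separable}\}}.$$ Then for every $\alpha\in[F\setminus\mathcal A]$ the current $\eta_\alpha$ is non-zero, and $[\eta_\alpha]\in\mathcal{MRC}(\mathcal A)$ if and only if $\alpha$ is $\mathcal A$-separable. -/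

import Mathlib

open Set Topology
open scoped Pointwise NNReal

noncomputable section

namespace RelCurrents

/-! ### Free factor systems -/

section FreeFactorSystems

variable {F : Type*} [Group F]

/-- A free factor system `{[A₁], …, [A_k]}` of `F`, given by representatives `A₁, …, A_k` (which are
non-trivial subgroups) together with a free factorization `F = A₁ * ⋯ * A_k * F_N`, where the
cofactor `F_N` is free of rank `N`. -/
structure FreeFactorSystem (F : Type*) [Group F] where
  /-- the number of factors -/
  k : ℕ
  /-- representatives of the conjugacy classes of factors -/
  factor : Fin k → Subgroup F
  /-- the rank of the cofactor -/
  N : ℕ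
  /-- the embedding of the cofactor -/
  cofactor : FreeGroup (Fin N) →* F
  factor_ne_bot : ∀ i, factor i ≠ ⊥
  bijective : Function.Bijective
    (Monoid.Coprod.lift (Monoid.CoprodI.lift fun i => (factor i).subtype) cofactor)

namespace FreeFactorSystem

/-- A free factor system is non-trivial if it is neither `∅` nor `{[F]}`. -/
def IsNontrivial (A : FreeFactorSystem F) : Prop := A.k ≠ 0 ∧ ∀ i, A.factor i ≠ ⊤

/-- `ζ(A)`: the number of factors plus the rank of a cofactor. -/
def zeta (A : FreeFactorSystem F) : ℕ := A.k + A.N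

/-- The partial order `A ⊏ D`: every factor of `A` is, up to conjugation, contained in a factor
of `D`. -/
def Sqsubset (A D : FreeFactorSystem F) : Prop :=
  ∀ i, ∃ j, ∃ g : F, ∀ x ∈ A.factor i, g * x * g⁻¹ ∈ D.factor j

/-- The conjugacy class of `a` is contained in the conjugacy class of some factor of `A`. -/
def Carries (A : FreeFactorSystem F) (a : F) : Prop := ∃ i, ∃ g : F, g * a * g⁻¹ ∈ A.factor i

/-- The conjugacy class of `a` is `A`-separable: it is contained in a non-trivial free factor
system that contains `A`. -/
def IsSeparable (A : FreeFactorSystem F) (a : F) : Prop :=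
  ∃ D : FreeFactorSystem F, D.IsNontrivial ∧ A.Sqsubset D ∧ D.Carries a

end FreeFactorSystem

end FreeFactorSystems

/-! ### Unoriented bi-infinite geodesics in the Cayley graph -/

section Lines

variable {F ι : Type*} [Group F] (b : FreeGroupBasis ι F)

/-- `γ` is a bi-infinite geodesic edge path in the Cayley graph of `F` with respect to `b`, a tree:
consecutive vertices are adjacent and there is no backtracking. -/
structure IsGeodesic (γ : ℤ → F) : Prop where
  adj : ∀ n, ∃ i, γ (n + 1) = γ n * b i ∨ γ (n + 1) = γ n * (b i)⁻¹
  not_backtrack : ∀ n, γ (n + 2) ≠ γ n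

/-- The double boundary `∂²F`: the unoriented, unparametrized bi-infinite geodesics in the Cayley
graph of `F` with respect to `b`. Since the graph is a tree, such a geodesic is determined by its
set of vertices, and it is recorded as this set. -/
def Line : Type _ := {L : Set F // ∃ γ : ℤ → F, IsGeodesic b γ ∧ range γ = L}

variable {b}

/-- The set of vertices of a bi-infinite geodesic. -/
def Line.verts (L : Line b) : Set F := L.1

theorem Line.ext' {L L' : Line b} (h : L.verts = L'.verts) : L = L' := Subtype.ext h

variable (b)

/-- The two-sided cylinder set of the path from `g` to `h` in the Cayley graph: the bi-infinite
geodesics that cross this path, that is, that pass through both its end points. -/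
def cylinder (g h : F) : Set (Line b) := {L | g ∈ L.verts ∧ h ∈ L.verts}

/-- The topology of `∂²F` is generated by the two-sided cylinder sets. -/
instance : TopologicalSpace (Line b) :=
  TopologicalSpace.generateFrom {C | ∃ g h : F, C = cylinder b g h}

variable {b}

theorem IsGeodesic.smul {γ : ℤ → F} (h : IsGeodesic b γ) (g : F) :
    IsGeodesic b fun n => g * γ n where
  adj n := by
    obtain ⟨i, hi | hi⟩ := h.adj n
    · exact ⟨i, Or.inl (by rw [hi, mul_assoc])⟩
    · exact ⟨i, Or.inr (by rw [hi, mul_assoc])⟩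
  not_backtrack n hn := h.not_backtrack n (mul_left_cancel hn)

/-- `F` acts on `∂²F` by left translation. -/
instance : MulAction F (Line b) where
  smul g L := ⟨g • L.1, by
    obtain ⟨γ, h, hL⟩ := L.2
    refine ⟨_, h.smul g, ?_⟩
    rw [← hL]
    ext x
    simp [Set.mem_smul_set]⟩
  one_smul L := Line.ext' (one_smul F L.1)
  mul_smul g h L := Line.ext' (mul_smul g h L.1)

theorem Line.verts_smul (g : F) (L : Line b) : (g • L).verts = g • L.verts := rfl

/-- A letter of a word, as an element of `F`. -/
def letter (b : FreeGroupBasis ι F) (x : ι × Bool) : F := b.repr.symm (FreeGroup.mk [x])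

theorem letter_eq (x : ι × Bool) : ∃ i, letter b x = b i ∨ letter b x = (b i)⁻¹ := by
  obtain ⟨i, e⟩ := x
  refine ⟨i, ?_⟩
  cases e
  · right
    change b.repr.symm _ = (b.repr.symm (FreeGroup.of i))⁻¹
    rw [← map_inv]
    rfl
  · left
    rfl

theorem letter_mul_ne_one {x y : ι × Bool} (h : x.1 = y.1 → x.2 = y.2) :
    letter b x * letter b y ≠ 1 := by
  classical
  unfold letter
  rw [← map_mul, FreeGroup.mul_mk]
  intro h1
  have h2 : FreeGroup.mk ([x] ++ [y]) = 1 := by simpa using h1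
  have h3 : FreeGroup.IsReduced ([x] ++ [y]) := by simpa using h
  have h4 := congrArg FreeGroup.toWord h2
  rw [FreeGroup.toWord_mk, h3.reduce_eq] at h4
  simp at h4

theorem symm_mk_append (u v : List (ι × Bool)) :
    b.repr.symm (FreeGroup.mk (u ++ v)) =
      b.repr.symm (FreeGroup.mk u) * b.repr.symm (FreeGroup.mk v) := by
  rw [← map_mul, FreeGroup.mul_mk]

/-- Every non-trivial element `a` of `F` has an axis: a bi-infinite geodesic along which `a`
translates. -/
theorem exists_axis (b : FreeGroupBasis ι F) {a : F} (ha : a ≠ 1) :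
    ∃ L : Line b, ∃ γ : ℤ → F, IsGeodesic b γ ∧ range γ = L.verts ∧
      ∃ l : ℕ, 0 < l ∧ ∀ n, γ (n + l) = a * γ n := by
  classical
  set u := (b.repr a).toWord with hu
  set w := FreeGroup.reduceCyclically u with hw
  set c : F := b.repr.symm (FreeGroup.mk (FreeGroup.reduceCyclically.conjugator u)) with hc
  set W : F := b.repr.symm (FreeGroup.mk w) with hW
  have hacW : a = c * W * c⁻¹ := by
    have h := FreeGroup.reduceCyclically.conj_conjugator_reduceCyclically u
    have h2 : a = b.repr.symm (FreeGroup.mk u) := by rw [hu, FreeGroup.mk_toWord]; simp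
    rw [h2, ← h, symm_mk_append, symm_mk_append, ← FreeGroup.inv_mk, map_inv]
  have hcyc : FreeGroup.IsCyclicallyReduced w :=
    FreeGroup.reduceCyclically.isCyclicallyReduced FreeGroup.isReduced_toWord
  have hl : 0 < w.length := by
    rw [List.length_pos_iff]
    intro h0
    apply ha
    rw [hacW, hW, h0, ← FreeGroup.one_eq_mk]
    simp
  set l := w.length with hl'
  let p : ℕ → F := fun i => b.repr.symm (FreeGroup.mk (w.take i))
  let γ : ℤ → F := fun n => c * W ^ (n / l) * p (n % l).toNat
  let s : ℤ → ι × Bool := fun n =>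
    w[(n % l).toNat]'(by have := Int.emod_lt_of_pos n (Int.natCast_pos.2 hl)
                         have := Int.emod_nonneg n (Int.natCast_pos.2 hl).ne'
                         omega)
  have hl0 : (l : ℤ) ≠ 0 := by omega
  have hmod : ∀ n : ℤ, (n % l).toNat < l ∧ 0 ≤ n % l := fun n => by
    have := Int.emod_lt_of_pos n (Int.natCast_pos.2 hl)
    have := Int.emod_nonneg n hl0
    omega
  have hnext : ∀ n : ℤ, ((n % l).toNat + 1 < l ∧ (n + 1) / l = n / l ∧
      ((n + 1) % l).toNat = (n % l).toNat + 1) ∨ ((n % l).toNat + 1 = l ∧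
      (n + 1) / l = n / l + 1 ∧ ((n + 1) % l).toNat = 0) := by
    intro n
    have h1 := hmod n
    have h2 := hmod (n + 1)
    have e1 := Int.emod_add_mul_ediv n l
    have e2 := Int.emod_add_mul_ediv (n + 1) l
    rcases lt_or_eq_of_le (Nat.succ_le_of_lt h1.1) with h | h
    · left
      have := (Int.ediv_emod_unique (a := n + 1) (b := l) (r := n % l + 1) (q := n / l)
        (by omega)).2 ⟨by linarith, by omega, by omega⟩
      exact ⟨h, this.1, by omega⟩
    · right
      have := (Int.ediv_emod_unique (a := n + 1) (b := l) (r := 0) (q := n / l + 1)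
        (by omega)).2 ⟨by
          have : n % l = l - 1 := by omega
          rw [this] at e1
          linarith, by omega, by omega⟩
      exact ⟨h, this.1, by omega⟩
  have hp : ∀ i (hi : i < l), p (i + 1) = p i * letter b w[i] := by
    intro i hi
    simp only [p, letter]
    rw [← symm_mk_append, List.take_append_getElem]
  have hp0 : p 0 = 1 := by simp [p, ← FreeGroup.one_eq_mk]
  have hpl : p l = W := by simp [p, hW, hl']
  have hstep : ∀ n, γ (n + 1) = γ n * letter b (s n) := by
    intro n
    have h3 := hp _ (hmod n).1
    rcases hnext n with ⟨h, e1, e2⟩ | ⟨h, e1, e2⟩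
    · simp only [γ, s]
      rw [e1, e2, h3, ← mul_assoc]
    · rw [h, hpl] at h3
      simp only [γ, s]
      rw [e1, e2, hp0, mul_one, zpow_add_one, h3]
      simp only [mul_assoc]
  have hs : ∀ n, (s n).1 = (s (n + 1)).1 → (s n).2 = (s (n + 1)).2 := by
    intro n
    rcases hnext n with ⟨h, -, e2⟩ | ⟨h, -, e2⟩
    · have h4 := List.isChain_iff_getElem.1 hcyc.isReduced (n % l).toNat h
      simpa only [s, e2] using h4
    · refine hcyc.2 (s n) ?_ (s (n + 1)) ?_
      · rw [List.getLast?_eq_getElem?, Option.mem_def, List.getElem?_eq_some_iff]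
        refine ⟨by omega, ?_⟩
        simp only [s]
        congr 1
        omega
      · rw [List.head?_eq_getElem?, Option.mem_def, List.getElem?_eq_some_iff]
        refine ⟨by omega, ?_⟩
        simp only [s, e2]
  have hgeo : IsGeodesic b γ := by
    refine ⟨fun n => ?_, fun n => ?_⟩
    · obtain ⟨i, hi | hi⟩ := letter_eq (b := b) (s n)
      · exact ⟨i, Or.inl (by rw [hstep, hi])⟩
      · exact ⟨i, Or.inr (by rw [hstep, hi])⟩
    · have : n + 2 = n + 1 + 1 := by ring
      rw [this, hstep, hstep, mul_assoc]
      intro h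
      exact letter_mul_ne_one (hs n) (by simpa using h)
  refine ⟨⟨range γ, γ, hgeo, rfl⟩, γ, hgeo, rfl, l, hl, fun n => ?_⟩
  simp only [γ]
  rw [Int.add_emod_right, Int.add_ediv_of_dvd_right (dvd_refl _), Int.ediv_self hl0, add_comm,
    zpow_add, zpow_one, hacW]
  group

/-- The axis of a non-trivial element `a` of `F`: the (unique) bi-infinite geodesic along which `a`
translates. -/
def axis (b : FreeGroupBasis ι F) (a : F) (ha : a ≠ 1) : Line b := (exists_axis b ha).choose

theorem axis_spec (b : FreeGroupBasis ι F) (a : F) (ha : a ≠ 1) :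
    ∃ γ : ℤ → F, IsGeodesic b γ ∧ range γ = (axis b a ha).verts ∧
      ∃ l : ℕ, 0 < l ∧ ∀ n, γ (n + l) = a * γ n := (exists_axis b ha).choose_spec

end Lines

/-! ### The space `Y` and relative currents -/

section Currents

variable {F ι : Type*} [Group F] (b : FreeGroupBasis ι F) (A : FreeFactorSystem F)

/-- The double boundary of a subgroup `H`: the closure in `∂²F` of the set of all lifts of
conjugacy classes of (non-trivial) elements of `H`, that is, of all translates of their axes. -/
def subgroupBoundary (H : Subgroup F) : Set (Line b) :=
  closure {L | ∃ x ∈ H, ∃ hx : x ≠ 1, ∃ g : F, L = g • axis b x hx}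

/-- The double boundary `∂²A` of a free factor system. -/
def systemBoundary : Set (Line b) := ⋃ i, subgroupBoundary b (A.factor i)

/-- The space `Y = ∂²F \ ∂²A`, with the subspace topology. -/
abbrev Y : Type _ := {L : Line b // L ∉ systemBoundary b A}

variable {b A} in
/-- The set of bi-infinite geodesics underlying a compact open subset of `Y`. -/
def lines (C : TopologicalSpace.CompactOpens (Y b A)) : Set (Line b) :=
  Subtype.val '' (C : Set (Y b A))

/-- A relative current: a non-negative, additive, `F`-invariant function on the compact open
subsets of `Y`. (Flip-invariance is automatic, since the points of `Y` are unoriented.) -/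
structure RelCurrent where
  toFun : TopologicalSpace.CompactOpens (Y b A) → ℝ≥0
  additive : ∀ C D : TopologicalSpace.CompactOpens (Y b A), Disjoint (C : Set (Y b A)) (D : Set (Y b A)) →
    toFun (C ⊔ D) = toFun C + toFun D
  invariant : ∀ (g : F) (C D : TopologicalSpace.CompactOpens (Y b A)), lines D = g • lines C → toFun D = toFun C

/-- The space of relative currents has the topology of pointwise convergence on compact open
subsets of `Y`. -/
instance : TopologicalSpace (RelCurrent b A) :=
  TopologicalSpace.induced RelCurrent.toFun inferInstance

/-- The zero current. -/
instance : Zero (RelCurrent b A) := ⟨⟨fun _ => 0, by simp, by simp⟩⟩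

/-- Non-zero relative currents are projectively equivalent if they differ by a positive scalar. -/
def projSetoid : Setoid {η : RelCurrent b A // η ≠ 0} where
  r η θ := ∃ c : ℝ≥0, 0 < c ∧ ∀ C, θ.1.toFun C = c * η.1.toFun C
  iseqv :=
    { refl := fun η => ⟨1, one_pos, by simp⟩
      symm := by
        rintro η θ ⟨c, hc, h⟩
        refine ⟨c⁻¹, inv_pos.2 hc, fun C => ?_⟩
        rw [h, inv_mul_cancel_left₀ hc.ne']
      trans := by
        rintro η θ κ ⟨c, hc, h⟩ ⟨d, hd, h'⟩
        exact ⟨d * c, mul_pos hd hc, fun C => by rw [h', h, mul_assoc]⟩ }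

/-- The space of projectivized relative currents, with the quotient topology. -/
def ProjRelCurrent : Type _ := Quotient (projSetoid b A)

instance : TopologicalSpace (ProjRelCurrent b A) :=
  inferInstanceAs (TopologicalSpace (Quotient (projSetoid b A)))

variable {b A} in
/-- The projective class `[η]` of a non-zero relative current. -/
def projClass (η : RelCurrent b A) (h : η ≠ 0) : ProjRelCurrent b A :=
  Quotient.mk (projSetoid b A) ⟨η, h⟩

/-! ### Rational currents -/

variable {b A} in
/-- The group elements `g` that carry the axis of `a` into `C` (none if `a = 1`). -/
def liftSet (a : F) (C : TopologicalSpace.CompactOpens (Y b A)) : Set F :=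
  {g | ∃ ha : a ≠ 1, g • axis b a ha ∈ lines C}

variable {b A} in
/-- The number of cosets `g⟨a⟩` such that the translate by `g` of the axis of `a` lies in `C`. -/
def liftCount (a : F) (C : TopologicalSpace.CompactOpens (Y b A)) : ℕ :=
  ((fun g : F => (g : F ⧸ Subgroup.zpowers a)) '' liftSet a C).ncard

variable {b A}

theorem smul_axis (a : F) (ha : a ≠ 1) : a • axis b a ha = axis b a ha := by
  obtain ⟨γ, -, hγ, l, -, hl⟩ := axis_spec b a ha
  apply Line.ext'
  rw [Line.verts_smul, ← hγ]
  ext x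
  simp only [Set.mem_smul_set, mem_range, smul_eq_mul]
  constructor
  · rintro ⟨_, ⟨n, rfl⟩, rfl⟩
    exact ⟨_, hl n⟩
  · rintro ⟨n, rfl⟩
    exact ⟨_, ⟨n - l, rfl⟩, by rw [← hl]; congr 1; ring⟩

theorem smul_axis_of_mem_zpowers (a : F) (ha : a ≠ 1) {c : F} (hc : c ∈ Subgroup.zpowers a) :
    c • axis b a ha = axis b a ha := by
  have h : Subgroup.zpowers a ≤ MulAction.stabilizer F (axis b a ha) :=
    (Subgroup.zpowers_le).2 (smul_axis a ha)
  exact h hc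

theorem liftSet_of_coset {a g g' : F} {C : TopologicalSpace.CompactOpens (Y b A)}
    (h : (g : F ⧸ Subgroup.zpowers a) = g') (hg : g ∈ liftSet a C) : g' ∈ liftSet a C := by
  obtain ⟨ha, hg⟩ := hg
  refine ⟨ha, ?_⟩
  have h1 := smul_axis_of_mem_zpowers (b := b) a ha (QuotientGroup.eq.1 h)
  have h2 : g' = g * (g⁻¹ * g') := by group
  rw [h2, mul_smul, h1]
  exact hg

/-- Only finitely many lifts of a conjugacy class lie in a compact set of geodesics. -/
theorem finite_lifts (a : F) (C : TopologicalSpace.CompactOpens (Y b A)) :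
    ((fun g : F => (g : F ⧸ Subgroup.zpowers a)) '' liftSet a C).Finite := by
  by_cases ha : a = 1
  · have : liftSet a C = ∅ := by
      ext g
      simp [liftSet, ha]
    simp [this]
  have hcpt : IsCompact (lines C) := C.isCompact.image continuous_subtype_val
  obtain ⟨t, ht⟩ := hcpt.elim_finite_subcover (fun v : F => cylinder b v v)
    (fun v => TopologicalSpace.isOpen_generateFrom_of_mem ⟨v, v, rfl⟩) (by
      intro L _
      obtain ⟨γ, -, hγ⟩ := L.2
      refine mem_iUnion.2 ⟨γ 0, ?_⟩
      have : γ 0 ∈ L.verts := by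
        change γ 0 ∈ L.1
        rw [← hγ]
        exact mem_range_self 0
      exact ⟨this, this⟩)
  obtain ⟨γ, -, hγ, l, hl0, hl⟩ := axis_spec b a ha
  have hlz : ∀ (m : ℕ) n, γ (n + l * m) = a ^ m * γ n := by
    intro m
    induction m with
    | zero => simp
    | succ m ih =>
      intro n
      have : n + (l : ℤ) * ((m + 1 : ℕ) : ℤ) = (n + l * m) + l := by push_cast; ring
      rw [this, hl, ih, ← mul_assoc, ← pow_succ']
  have hfin : (⋃ v ∈ t, ⋃ i ∈ Finset.range l,
      {((v * (γ i)⁻¹ : F) : F ⧸ Subgroup.zpowers a)}).Finite := by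
    refine Set.Finite.biUnion t.finite_toSet fun v _ => ?_
    exact Set.Finite.biUnion (Finset.range l).finite_toSet fun i _ => Set.finite_singleton _
  refine hfin.subset ?_
  rintro _ ⟨g, ⟨_, hg⟩, rfl⟩
  obtain ⟨v, hv, hgv⟩ := mem_iUnion₂.1 (ht hg)
  have hgv := hgv.1
  rw [Line.verts_smul, ← hγ, Set.mem_smul_set] at hgv
  obtain ⟨_, ⟨n, rfl⟩, rfl⟩ := hgv
  have hlpos : (0 : ℤ) < l := by exact_mod_cast hl0
  have h1 := Int.emod_nonneg n hlpos.ne'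
  have h2 := Int.emod_lt_of_pos n hlpos
  have h3 : ∃ k : ℤ, γ n = a ^ k * γ ((n % l).toNat : ℤ) := by
    have e := Int.emod_add_mul_ediv n l
    rw [Int.toNat_of_nonneg h1]
    rcases Int.eq_nat_or_neg (n / l) with ⟨m, hm | hm⟩
    · refine ⟨m, ?_⟩
      rw [zpow_natCast, ← hlz, ← hm, e]
    · refine ⟨-m, ?_⟩
      rw [zpow_neg, zpow_natCast, eq_inv_mul_iff_mul_eq, ← hlz]
      congr 1
      rw [hm] at e
      linarith
  obtain ⟨k, hk⟩ := h3
  refine mem_iUnion₂.2 ⟨_, hv, mem_iUnion₂.2 ⟨(n % l).toNat, by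
    rw [Finset.mem_range]; omega, ?_⟩⟩
  rw [mem_singleton_iff, QuotientGroup.eq]
  refine Subgroup.mem_zpowers_iff.2 ⟨k, ?_⟩
  rw [smul_eq_mul, hk]
  group

variable (b A) in
/-- The rational relative current `η_α` of the conjugacy class `α` of `a`: its value on `C` is the
number of lifts of `α` in `C`. If `a` is not a proper power, then the lifts of `α` to the Cayley
graph are the translates of the axis of `a`, and they correspond to the cosets `g⟨a⟩`; if `a = r ^ m`
with `m > 0` and `r` not a proper power, then the value is `m` times the one for `r`. -/
def rationalCurrent (a : F) : RelCurrent b A where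
  toFun C := liftCount a C
  additive C D hCD := by
    have hunion : liftSet a (C ⊔ D) = liftSet a C ∪ liftSet a D := by
      ext g
      simp only [liftSet, lines, TopologicalSpace.CompactOpens.coe_sup, image_union, mem_union,
        mem_ofPred_eq]
      constructor
      · rintro ⟨ha, h | h⟩
        · exact Or.inl ⟨ha, h⟩
        · exact Or.inr ⟨ha, h⟩
      · rintro (⟨ha, h⟩ | ⟨ha, h⟩)
        · exact ⟨ha, Or.inl h⟩
        · exact ⟨ha, Or.inr h⟩
    have hdisj : Disjoint ((fun g : F => (g : F ⧸ Subgroup.zpowers a)) '' liftSet a C)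
        ((fun g : F => (g : F ⧸ Subgroup.zpowers a)) '' liftSet a D) := by
      rw [Set.disjoint_left]
      rintro _ ⟨g, hg, rfl⟩ ⟨g', hg', h⟩
      obtain ⟨ha, y, hy, hy'⟩ := liftSet_of_coset h hg'
      obtain ⟨_, z, hz, hz'⟩ := hg
      have : y = z := Subtype.ext (hy'.trans hz'.symm)
      subst this
      exact Set.disjoint_left.1 hCD hz hy
    unfold liftCount
    rw [hunion, image_union, Set.ncard_union_eq hdisj (finite_lifts a C) (finite_lifts a D)]
    push_cast
    rfl
  invariant g C D h := by
    have hD : (fun g : F => (g : F ⧸ Subgroup.zpowers a)) '' liftSet a D =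
        g • ((fun g : F => (g : F ⧸ Subgroup.zpowers a)) '' liftSet a C) := by
      ext x
      rw [Set.mem_smul_set]
      constructor
      · rintro ⟨g', ⟨ha, hg'⟩, rfl⟩
        rw [h, Set.mem_smul_set_iff_inv_smul_mem, smul_smul] at hg'
        exact ⟨_, ⟨g⁻¹ * g', ⟨ha, hg'⟩, rfl⟩, by simp⟩
      · rintro ⟨_, ⟨g', ⟨ha, hg'⟩, rfl⟩, rfl⟩
        refine ⟨g * g', ⟨ha, ?_⟩, rfl⟩
        rw [h, mul_smul]
        exact Set.smul_mem_smul_set hg'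
    unfold liftCount
    rw [hD, Set.ncard_smul_set]

variable (b A)

/-- `MRC(A)`: the closure, in the space of projectivized relative currents, of the set of the
classes `[η_α]` of the `A`-separable conjugacy classes `α` that are not contained in `A`. -/
def MRC : Set (ProjRelCurrent b A) :=
  closure {p | ∃ (v : F) (h : rationalCurrent b A v ≠ 0),
    ¬ A.Carries v ∧ A.IsSeparable v ∧ p = projClass (rationalCurrent b A v) h}

end Currents

end RelCurrents

end

noncomputable section

namespace RelCurrents

/-! ### Almost invariant sets and the ends of cyclic subgroups -/

section AlmostInvariant

open Filter

variable {F : Type*} [Group F]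

/-! An `A`-separable class belongs to the set whose closure is `MRC`, so two things need proof:
`η_α` is never zero, and a non-separable class has a neighbourhood without separable ones. Both rest
on compact open subsets of `Y` consisting of the lines from `U` to `V`, where `U` and `V` are
disjoint sets of vertices with finite coboundary. Finiteness of the coboundary does not depend on
the basis, so half-trees of any basis may be used although `Y` is defined by `b`. If no axis of an
element of `A` leads from `V` to `U`, these lines avoid `∂²A` (`exists_compactOpens`).

Non-vanishing (`exists_separating_sets`): let `U` and `V` lie at the two ends of a long segment of
the axis of `a`. A translate of an axis of `x ∈ A_i` joining them would follow this segment. By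
pigeonhole a conjugate of a power of `a` would lie in `A_i`, and `A_i`, being a retract, would
contain the root as well.

Non-separable classes: take a basis minimizing the total cyclic length of `a`, of finite generating
sets of the factors and of products of two generators. By Whitehead's argument the Whitehead graph
of these elements is connected without cut vertex, or a partition of the basis makes all of them
elliptic in a free splitting. In the second case whole factors are elliptic, by the products of
pairs, and `a` is separable. So there is no cut vertex (`exists_basis_noCutVertex`). Each of the
finitely many edges given by `a` is also given by an element of `A`, or else defines a compact open
subset of `Y` on which `η_a` is positive. Positivity on these sets is an open condition, and any `v`
satisfying it supplies the same edges.

If such a `v` were separable, then `v` and `A` would be carried by a non-trivial system `D`. One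
side of an edge of a splitting given by `D` is an infinite, co-infinite almost invariant set that no
axis of an element carried by `D` crosses (`exists_almostInvariant`). A Whitehead graph without cut
vertex forbids such a set (`finite_or_finite_of_noCutVertex`). -/

/-- `X` has finite coboundary: every right translate of `X` differs from `X` by a finite set. -/
def AlmostInvariant (X : Set F) : Prop := ∀ h, {x | ¬(x ∈ X ↔ x * h ∈ X)}.Finite

/-- The ray `g, g * y, g * y ^ 2, …` eventually stays in `X`. -/
def EndsIn (y g : F) (X : Set F) : Prop := ∀ᶠ n : ℕ in atTop, g * y ^ n ∈ X

/-- Some translate of the axis of `y` leads from `V` to `U`. -/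
def Connects (y : F) (U V : Set F) : Prop := ∃ g, EndsIn y g U ∧ EndsIn y⁻¹ g V

/-- The exceptional set of a product `s * t` lies in that of `s` together with a translate of that
of `t`. -/
theorem almostInvariant_of_closure {X : Set F} (T : Set F) (hT : Subgroup.closure T = ⊤)
    (h : ∀ t ∈ T, {x | ¬(x ∈ X ↔ x * t ∈ X)}.Finite) : AlmostInvariant X := by
  intro k
  have hk : k ∈ Subgroup.closure T := hT ▸ Subgroup.mem_top k
  induction hk using Subgroup.closure_induction with
  | mem t ht => exact h t ht
  | one => simp
  | mul s t _ _ hs ht =>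
    refine (hs.union (ht.preimage (f := fun x => x * s) (mul_left_injective s).injOn)).subset ?_
    intro x hx
    simp only [mem_ofPred_eq, mem_union, mem_preimage, mul_assoc] at hx ⊢
    tauto
  | inv s _ hs =>
    refine (hs.preimage (f := fun x => x * s⁻¹) (mul_left_injective s⁻¹).injOn).subset ?_
    intro x hx
    simp only [mem_ofPred_eq, mem_preimage, inv_mul_cancel_right] at hx ⊢
    tauto

theorem AlmostInvariant.compl {X : Set F} (hX : AlmostInvariant X) : AlmostInvariant Xᶜ := by
  intro h
  refine (hX h).subset fun x hx => ?_
  simp only [mem_ofPred_eq, mem_compl_iff] at hx ⊢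
  tauto

theorem AlmostInvariant.smul {X : Set F} (hX : AlmostInvariant X) (g : F) :
    AlmostInvariant (g • X) := by
  intro h
  refine ((hX h).preimage (f := fun x => g⁻¹ * x) (mul_right_injective g⁻¹).injOn).subset ?_
  intro x hx
  simpa only [mem_ofPred_eq, mem_preimage, Set.mem_smul_set_iff_inv_smul_mem, smul_eq_mul,
    mul_assoc] using hx

theorem EndsIn.mono {y g : F} {X X' : Set F} (h : EndsIn y g X) (hX : X ⊆ X') : EndsIn y g X' :=
  Filter.Eventually.mono h fun _ hn => hX hn

theorem EndsIn.nonempty {y g : F} {X : Set F} (h : EndsIn y g X) : X.Nonempty :=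
  let ⟨_, hn⟩ := Filter.Eventually.exists h
  ⟨_, hn⟩

theorem EndsIn.inter {y g : F} {X X' : Set F} (h : EndsIn y g X) (h' : EndsIn y g X') :
    EndsIn y g (X ∩ X') := (Filter.Eventually.and h h').mono fun _ hn => hn

theorem endsIn_smul {y g h : F} {X : Set F} : EndsIn y g (h • X) ↔ EndsIn y (h⁻¹ * g) X := by
  simp only [EndsIn, Set.mem_smul_set_iff_inv_smul_mem, smul_eq_mul, mul_assoc]

theorem Connects.symm {y : F} {U V : Set F} (h : Connects y U V) : Connects y⁻¹ V U := by
  obtain ⟨g, h1, h2⟩ := h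
  exact ⟨g, h2, by rwa [inv_inv]⟩

variable [IsMulTorsionFree F]

theorem injective_mul_pow {y : F} (hy : y ≠ 1) (g : F) :
    Function.Injective fun n : ℕ => g * y ^ n := by
  have h := injective_pow_iff_not_isOfFinOrder.2 (not_isOfFinOrder_of_isMulTorsionFree hy)
  exact fun m n hmn => h (mul_left_cancel hmn)

theorem endsIn_compl_of_finite {y : F} (hy : y ≠ 1) (g : F) {Φ : Set F} (hΦ : Φ.Finite) :
    EndsIn y g Φᶜ := by
  have h := (injective_mul_pow hy g).tendsto_cofinite
  rw [Nat.cofinite_eq_atTop] at h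
  exact h.eventually hΦ.compl_mem_cofinite

theorem EndsIn.of_diff_finite {y g : F} (hy : y ≠ 1) {X X' : Set F} (h : EndsIn y g X)
    (hX : (X \ X').Finite) : EndsIn y g X' :=
  (h.inter (endsIn_compl_of_finite hy g hX)).mono fun x hx => by
    by_contra hx'
    exact hx.2 ⟨hx.1, hx'⟩

/-- The points `g * y ^ n` are distinct, so only finitely many lie in the finite set where right
multiplication by `y` changes membership in `X`. -/
theorem AlmostInvariant.endsIn_or {X : Set F} (hX : AlmostInvariant X) {y : F} (hy : y ≠ 1)
    (g : F) : EndsIn y g X ∨ EndsIn y g Xᶜ := by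
  obtain ⟨N, hN⟩ := eventually_atTop.1 (endsIn_compl_of_finite hy g (hX y))
  have hst : ∀ n, N ≤ n → (g * y ^ n ∈ X ↔ g * y ^ N ∈ X) := by
    intro n hn
    induction n, hn using Nat.le_induction with
    | base => rfl
    | succ n hn ih =>
      have := hN n hn
      simp only [mem_compl_iff, mem_ofPred_eq, not_not, mul_assoc, ← pow_succ] at this
      rw [← this, ih]
  by_cases h : g * y ^ N ∈ X
  · exact Or.inl (eventually_atTop.2 ⟨N, fun n hn => (hst n hn).2 h⟩)
  · exact Or.inr (eventually_atTop.2 ⟨N, fun n hn => fun h' => h ((hst n hn).1 h')⟩)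

/-- Parallel rays have the same end. This makes `Connects` a property of the conjugacy class of `y`.
-/
theorem AlmostInvariant.endsIn_mul_right {X : Set F} (hX : AlmostInvariant X) {y g : F}
    (hy : y ≠ 1) (h : EndsIn y g X) (k : F) : ∀ᶠ n : ℕ in atTop, g * y ^ n * k ∈ X := by
  filter_upwards [h, endsIn_compl_of_finite hy g (hX k)] with n h1 h2
  simp only [mem_compl_iff, mem_ofPred_eq, not_not] at h2
  exact h2.1 h1

theorem AlmostInvariant.endsIn_conj {X : Set F} (hX : AlmostInvariant X) {y g : F}
    (hy : y ≠ 1) (h : EndsIn y g X) (c : F) : EndsIn (c * y * c⁻¹) (g * c⁻¹) X := by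
  filter_upwards [hX.endsIn_mul_right hy h c⁻¹] with n hn
  rw [conj_pow]
  convert hn using 1
  group

theorem Connects.conj {y : F} (hy : y ≠ 1) {U V : Set F} (hU : AlmostInvariant U)
    (hV : AlmostInvariant V) (h : Connects y U V) (c : F) : Connects (c * y * c⁻¹) U V := by
  obtain ⟨g, h1, h2⟩ := h
  refine ⟨g * c⁻¹, hU.endsIn_conj hy h1 c, ?_⟩
  have := hV.endsIn_conj (inv_ne_one.2 hy) h2 c
  rwa [← conj_inv] at this

/-- If `X` agrees up to a finite set with a set that is right invariant under `K`, then no axis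
of a conjugate of an element of `K` crosses `X`. -/
theorem not_connects_of_invariant {X X' : Set F} (hX : AlmostInvariant X) {K : Subgroup F}
    (h1 : (X \ X').Finite) (h2 : (X' \ X).Finite) (hK : ∀ k ∈ K, ∀ x, x ∈ X' → x * k ∈ X')
    {y c : F} (hy : y ≠ 1) (hc : c * y * c⁻¹ ∈ K) : ¬ Connects y X Xᶜ := by
  intro h
  obtain ⟨g, h3, h4⟩ := h.conj hy hX hX.compl c
  set z := c * y * c⁻¹
  have hz : z ≠ 1 := by simpa [z] using hy
  have h5 := h3.of_diff_finite hz h1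
  have h6 : EndsIn z⁻¹ g X'ᶜ := h4.of_diff_finite (inv_ne_one.2 hz) (h2.subset fun x hx =>
    ⟨not_not.1 hx.2, hx.1⟩)
  obtain ⟨n, hn⟩ := h5.exists
  obtain ⟨m, hm⟩ := h6.exists
  apply hm
  -- Both ends of the axis run in one left coset of `K`, and `X'` is a union of such cosets.
  have := hK _ (K.mul_mem (K.pow_mem (K.inv_mem hc) n) (K.pow_mem (K.inv_mem hc) m)) _ hn
  convert this using 1
  rw [inv_pow z n, ← mul_assoc, mul_inv_cancel_right]

end AlmostInvariant

/-! ### Free factor systems: generation, retractions, and almost invariant sets -/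

namespace FreeFactorSystem

variable {F : Type*} [Group F] (D : FreeFactorSystem F)

/-- The isomorphism from the free product of the factors and the cofactor to `F`. -/
def equiv : Monoid.Coprod (Monoid.CoprodI fun i => D.factor i) (FreeGroup (Fin D.N)) ≃* F :=
  MulEquiv.ofBijective _ D.bijective

theorem equiv_factor {i : Fin D.k} (x : D.factor i) :
    D.equiv (Monoid.Coprod.inl (Monoid.CoprodI.of x)) = x := by
  simp [equiv]

theorem equiv_cofactor (x : FreeGroup (Fin D.N)) :
    D.equiv (Monoid.Coprod.inr x) = D.cofactor x := by
  simp [equiv]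

theorem eq_top_of_le {S : Subgroup F} (h1 : ∀ i, D.factor i ≤ S)
    (h2 : ∀ x, D.cofactor x ∈ S) : S = ⊤ := by
  rw [eq_top_iff]
  rintro x -
  obtain ⟨c, rfl⟩ := D.equiv.surjective x
  induction c using Monoid.Coprod.induction_on with
  | inl c =>
    induction c using Monoid.CoprodI.induction_on with
    | one => simp [S.one_mem]
    | of i m => rw [equiv_factor]; exact h1 i m.2
    | mul c d hc hd => rw [map_mul, map_mul]; exact S.mul_mem hc hd
  | inr c => rw [equiv_cofactor]; exact h2 c
  | mul c d hc hd => rw [map_mul]; exact S.mul_mem hc hd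

/-- Homomorphisms on the factors and on the cofactor extend to `F`. -/
theorem exists_hom {H : Type*} [Group H] (f : ∀ i, D.factor i →* H)
    (f' : FreeGroup (Fin D.N) →* H) :
    ∃ Φ : F →* H, (∀ i (x : D.factor i), Φ x = f i x) ∧ ∀ x, Φ (D.cofactor x) = f' x := by
  refine ⟨(Monoid.Coprod.lift (Monoid.CoprodI.lift f) f').comp D.equiv.symm.toMonoidHom,
    fun i x => ?_, fun x => ?_⟩
  · rw [← D.equiv_factor x]
    simp
  · rw [← D.equiv_cofactor x]
    simp

/-- A factor is a retract. -/
theorem exists_retraction (i : Fin D.k) :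
    ∃ ρ : F →* F, (∀ x, ρ x ∈ D.factor i) ∧ ∀ x ∈ D.factor i, ρ x = x := by
  classical
  obtain ⟨Φ, h1, h2⟩ := D.exists_hom (H := F)
    (fun j => if j = i then (D.factor j).subtype else 1) 1
  refine ⟨Φ, fun x => ?_, fun x hx => by simpa using h1 i ⟨x, hx⟩⟩
  have : (D.factor i).comap Φ = ⊤ := by
    refine D.eq_top_of_le (fun j y hy => ?_) fun y => ?_
    · rw [Subgroup.mem_comap, h1 j ⟨y, hy⟩]
      split_ifs with hj
      · subst hj; exact hy
      · exact one_mem _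
    · rw [Subgroup.mem_comap, h2]
      exact one_mem _
  exact Subgroup.mem_comap.1 (this ▸ Subgroup.mem_top x)

/-- The retraction onto the factor maps the finite basis to a generating set. -/
theorem exists_generators {ι : Type*} [Finite ι] (b : FreeGroupBasis ι F) (i : Fin D.k) :
    ∃ T : Set F, T.Finite ∧ Subgroup.closure T = D.factor i := by
  obtain ⟨ρ, h1, h2⟩ := D.exists_retraction i
  refine ⟨range (fun j => ρ (b j)), finite_range _, le_antisymm ?_ ?_⟩
  · rw [Subgroup.closure_le]
    rintro _ ⟨j, rfl⟩
    exact h1 _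
  · intro x hx
    set K := Subgroup.closure (range fun j => ρ (b j))
    let f : F →* K := b.lift fun j => ⟨ρ (b j), Subgroup.subset_closure ⟨j, rfl⟩⟩
    have hf : K.subtype.comp f = ρ := b.ext_hom _ _ fun j => by simp [f]
    rw [← h2 x hx, ← hf]
    exact (f x).2

/-- The right regular action of `F` on `F × Bool`. -/
def regularHom (F : Type*) [Group F] : F →* Equiv.Perm (F × Bool) where
  toFun h :=
    { toFun := fun p => (p.1 * h⁻¹, p.2)
      invFun := fun p => (p.1 * h, p.2)
      left_inv := fun p => by simp
      right_inv := fun p => by simp }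
  map_one' := by ext p <;> simp
  map_mul' h k := by ext p <;> simp [mul_assoc]

/-- The transposition of the two points over `1`. -/
def flipOne (F : Type*) [Group F] : Equiv.Perm (F × Bool) := by
  classical exact
  { toFun := fun p => (p.1, if p.1 = 1 then !p.2 else p.2)
    invFun := fun p => (p.1, if p.1 = 1 then !p.2 else p.2)
    left_inv := fun p => by ext <;> by_cases h : p.1 = 1 <;> simp [h]
    right_inv := fun p => by ext <;> by_cases h : p.1 = 1 <;> simp [h] }

/-- `X` consists of the elements whose normal form, in the splitting of `F` into the factor `j₀` and
the rest, begins with a syllable from `j₀`. To avoid normal forms, `F` acts on two copies of itself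
by right translation, with the action of the factor `j₀` conjugated by a switch of the two points
over `1`. -/
theorem exists_almostInvariant [IsMulTorsionFree F] (hD : D.IsNontrivial) :
    ∃ X : Set F, AlmostInvariant X ∧ X.Infinite ∧ Xᶜ.Infinite ∧
      ∀ y, y ≠ 1 → D.Carries y → ¬ Connects y X Xᶜ := by
  classical
  obtain ⟨j₀⟩ : Nonempty (Fin D.k) := ⟨⟨0, Nat.pos_of_ne_zero hD.1⟩⟩
  obtain ⟨Φ, h1, h2⟩ := D.exists_hom
    (fun j => if j = j₀ then (((MulAut.conj (flipOne F)).toMonoidHom.comp (regularHom F)).comp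
      (D.factor j).subtype) else (regularHom F).comp (D.factor j).subtype)
    ((regularHom F).comp D.cofactor)
  have hstd : ∀ j, j ≠ j₀ → ∀ k ∈ D.factor j, Φ k = regularHom F k := by
    intro j hj k hk
    rw [h1 j ⟨k, hk⟩, if_neg hj]
    rfl
  have hconj : ∀ k ∈ D.factor j₀, Φ k = flipOne F * regularHom F k * (flipOne F)⁻¹ := by
    intro k hk
    rw [h1 j₀ ⟨k, hk⟩, if_pos rfl]
    rfl
  -- The switch preserves first coordinates, so the twisted action still covers right translation.
  have hfst : ∀ k p, (Φ k p).1 = p.1 * k⁻¹ := by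
    let S : Subgroup F :=
      { carrier := {k | ∀ p, (Φ k p).1 = p.1 * k⁻¹}
        one_mem' := by simp
        mul_mem' := by
          intro k l hk hl p
          simp only [mem_ofPred_eq] at hk hl
          rw [map_mul, Equiv.Perm.mul_apply, hk, hl, mul_inv_rev, mul_assoc]
        inv_mem' := by
          intro k hk p
          simp only [mem_ofPred_eq] at hk
          have := hk (Φ k⁻¹ p)
          rw [← Equiv.Perm.mul_apply, ← map_mul, mul_inv_cancel, map_one,
            Equiv.Perm.one_apply] at this
          rw [this]
          simp }
    have : S = ⊤ := by
      refine D.eq_top_of_le (fun j k hk p => ?_) fun x p => ?_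
      · by_cases hj : j = j₀
        · subst hj
          rw [hconj k hk]
          rfl
        · rw [hstd j hj k hk]
          rfl
      · rw [h2]
        rfl
    intro k
    exact (this ▸ Subgroup.mem_top k : k ∈ S)
  -- The sheet reached over `x` when starting from `(1, false)`.
  let X : Set F := {x | (Φ x⁻¹ (1, false)).2 = true}
  have hX1 : (1 : F) ∉ X := by
    change ¬(Φ 1⁻¹ (1, false)).2 = true
    rw [inv_one, map_one]
    simp
  have hXmul : ∀ x k, x * k ∈ X ↔ (Φ k⁻¹ (x, decide (x ∈ X))).2 = true := by
    intro x k
    have e : Φ x⁻¹ (1, false) = (x, decide (x ∈ X)) := by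
      ext
      · rw [hfst]; simp
      · simp [X]
    rw [← e, ← Equiv.Perm.mul_apply, ← map_mul, ← mul_inv_rev]
    rfl
  have hXstd : ∀ k, Φ k⁻¹ = regularHom F k⁻¹ → ∀ x, x * k ∈ X ↔ x ∈ X := by
    intro k hk x
    rw [hXmul, hk]
    simp [regularHom]
  -- `X` with the membership of `1` reversed. Because of the conjugation, the factor `j₀` preserves
  -- `X'`, while the other factors and the cofactor preserve `X`.
  let X' : Set F := {x | ¬(x ∈ X ↔ x = 1)}
  have hXconj : ∀ k ∈ D.factor j₀, ∀ x, x * k ∈ X' ↔ x ∈ X' := by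
    intro k hk x
    simp only [X', mem_ofPred_eq]
    rw [hXmul, hconj _ (inv_mem hk)]
    have : (flipOne F)⁻¹ (x, decide (x ∈ X)) = (x, if x = 1 then !decide (x ∈ X) else
      decide (x ∈ X)) := rfl
    simp only [Equiv.Perm.mul_apply, this]
    simp only [regularHom, flipOne, MonoidHom.coe_mk, OneHom.coe_mk, Equiv.coe_fn_mk, inv_inv]
    by_cases a1 : x = 1 <;> by_cases a2 : x * k = 1 <;> by_cases a3 : x ∈ X <;> simp [a1, a2, a3]
    all_goals simp_all
  have hd1 : (X \ X').Finite := (finite_singleton 1).subset fun x hx => by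
    simp only [X', mem_sdiff, mem_ofPred_eq, not_not] at hx
    exact hx.2.1 hx.1
  have hd2 : (X' \ X).Finite := (finite_singleton 1).subset fun x hx => by
    simp only [X', mem_sdiff, mem_ofPred_eq] at hx
    simp only [mem_singleton_iff]
    tauto
  have hai : AlmostInvariant X := by
    refine almostInvariant_of_closure
      ((⋃ j, (D.factor j : Set F)) ∪ range D.cofactor) ?_ ?_
    · refine D.eq_top_of_le (fun j x hx => Subgroup.subset_closure
        (Or.inl (mem_iUnion.2 ⟨j, hx⟩))) fun x => Subgroup.subset_closure (Or.inr ⟨x, rfl⟩)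
    · rintro t (ht | ⟨x, rfl⟩)
      · obtain ⟨j, hj⟩ := mem_iUnion.1 ht
        by_cases h : j = j₀
        · subst h
          refine (Set.toFinite {1, t⁻¹}).subset fun x hx => ?_
          have := hXconj t hj x
          simp only [X', mem_ofPred_eq] at this hx
          simp only [mem_insert_iff, mem_singleton_iff]
          rw [eq_inv_iff_mul_eq_one]
          tauto
        · simp [hXstd t (hstd j h _ (inv_mem hj))]
      · have : Φ (D.cofactor x)⁻¹ = regularHom F (D.cofactor x)⁻¹ := by
          rw [map_inv, h2, map_inv]
          rfl
        simp [hXstd _ this]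
  obtain ⟨k₀, hk₀, hk₀1⟩ := (D.factor j₀).ne_bot_iff_exists_ne_one.1 (D.factor_ne_bot j₀) |>.elim
    fun k hk => (⟨k.1, k.2, fun h => hk (Subtype.ext h)⟩ : ∃ k ∈ D.factor j₀, k ≠ 1)
  have hinf : ∀ Z : Set F, Z.Finite → (∀ x, x * k₀ ∈ Z ↔ x ∈ Z) → Z = ∅ := by
    intro Z hZ h
    by_contra hne
    obtain ⟨x, hx⟩ := nonempty_iff_ne_empty.2 hne
    refine infinite_of_injective_forall_mem (injective_mul_pow hk₀1 x) (fun n => ?_) hZ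
    induction n with
    | zero => simpa using hx
    | succ n ih => rw [pow_succ, ← mul_assoc, h]; exact ih
  refine ⟨X, hai, fun hfin => ?_, fun hfin => ?_, fun y hy ⟨j, c, hc⟩ => ?_⟩
  · have : X' = ∅ := hinf X' ((hfin.union hd2).subset fun x hx => by
      by_cases h : x ∈ X
      · exact Or.inl h
      · exact Or.inr ⟨hx, h⟩) (hXconj k₀ hk₀)
    have h1' : (1 : F) ∈ X' := by simp [X', hX1]
    rw [this] at h1'
    exact h1'
  · have : X'ᶜ = ∅ := hinf X'ᶜ ((hfin.union hd1).subset fun x hx => by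
      by_cases h : x ∈ X
      · exact Or.inr ⟨h, hx⟩
      · exact Or.inl h) (fun x => not_congr (hXconj k₀ hk₀ x))
    -- Now `X` is everything but `1`. Only `k = 1` preserves such a set, so the other factors and
    -- the cofactor are trivial and the factor `j₀` is all of `F`.
    have hne : ∀ x, x ≠ 1 → x ∈ X := by
      intro x hx
      have : x ∈ X' := by
        by_contra h
        have : x ∈ X'ᶜ := h
        simp_all
      simp only [X', mem_ofPred_eq] at this
      tauto
    have hno : ∀ k, (∀ x, x * k ∈ X ↔ x ∈ X) → k = 1 := by
      intro k hk
      by_contra hk1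
      have h3 := hk 1
      rw [one_mul] at h3
      exact hX1 (h3.1 (hne k hk1))
    refine hD.2 j₀ (D.eq_top_of_le (fun j k hk => ?_) fun x => ?_)
    · by_cases h : j = j₀
      · subst h; exact hk
      · rw [hno k (hXstd k (hstd j h _ (inv_mem hk)))]
        exact one_mem _
    · rw [hno (D.cofactor x) (hXstd _ (by rw [map_inv, h2, map_inv]; rfl))]
      exact one_mem _
  · by_cases h : j = j₀
    · subst h
      exact not_connects_of_invariant hai hd1 hd2 (fun k hk x => (hXconj k hk x).2) hy hc
    · exact not_connects_of_invariant (X' := X) hai (by simp) (by simp)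
        (fun k hk x => (hXstd k (hstd j h _ (inv_mem hk)) x).2) hy hc

end FreeFactorSystem

/-! ### Words in a basis and half-trees -/

section Words

variable {F ι : Type*} [Group F] (b : FreeGroupBasis ι F)

theorem isMulTorsionFree_of_basis (b : FreeGroupBasis ι F) : IsMulTorsionFree F where
  pow_left_injective n hn x y h := by
    have h2 := congrArg b.repr h
    simp only [map_pow] at h2
    exact b.repr.injective (pow_left_injective hn h2)

/-- The reduced word of an element of `F`. -/
def word (x : F) : List (ι × Bool) := by
  classical exact (b.repr x).toWord

/-- The element of `F` spelled by a word. -/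
def eval (L : List (ι × Bool)) : F := b.repr.symm (FreeGroup.mk L)

/-- The inverse letter. -/
abbrev bar (s : ι × Bool) : ι × Bool := (s.1, !s.2)

theorem bar_bar (s : ι × Bool) : bar (bar s) = s := by simp [bar]

theorem bar_ne (s : ι × Bool) : bar s ≠ s := by
  intro h
  have := congrArg Prod.snd h
  simp at this

theorem eval_nil : eval b [] = 1 := by
  rw [eval, ← FreeGroup.one_eq_mk, map_one]

theorem eval_append (u v : List (ι × Bool)) : eval b (u ++ v) = eval b u * eval b v :=
  symm_mk_append u v

theorem eval_cons (s : ι × Bool) (v : List (ι × Bool)) :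
    eval b (s :: v) = letter b s * eval b v := eval_append b [s] v

theorem eval_singleton (s : ι × Bool) : eval b [s] = letter b s := rfl

theorem eval_invRev (u : List (ι × Bool)) : eval b (FreeGroup.invRev u) = (eval b u)⁻¹ := by
  rw [eval, eval, ← FreeGroup.inv_mk, map_inv]

theorem letter_bar (s : ι × Bool) : letter b (bar s) = (letter b s)⁻¹ := by
  rw [← eval_singleton, ← eval_singleton, ← eval_invRev]
  simp [FreeGroup.invRev]

theorem letter_true (i : ι) : letter b (i, true) = b i := rfl

theorem eval_word (x : F) : eval b (word b x) = x := by
  classical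
  rw [eval, word, FreeGroup.mk_toWord]
  simp

theorem isReduced_word (x : F) : FreeGroup.IsReduced (word b x) := by
  classical exact FreeGroup.isReduced_toWord

variable {b} in
theorem word_eval {L : List (ι × Bool)} (h : FreeGroup.IsReduced L) : word b (eval b L) = L := by
  classical
  rw [eval, word, MulEquiv.apply_symm_apply, FreeGroup.toWord_mk, h.reduce_eq]

theorem word_inv (x : F) : word b x⁻¹ = FreeGroup.invRev (word b x) := by
  classical
  rw [word, map_inv, FreeGroup.toWord_inv]
  rfl

theorem word_one : word b 1 = [] := by
  rw [← eval_nil b, word_eval FreeGroup.IsReduced.nil]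

theorem word_eq_nil {x : F} : word b x = [] ↔ x = 1 := by
  refine ⟨fun h => ?_, fun h => h ▸ word_one b⟩
  rw [← eval_word b x, h, eval_nil]

theorem word_mul_letter (x : F) (t : ι × Bool) :
    word b x = word b (x * letter b t) ++ [bar t] ∨ word b (x * letter b t) = word b x ++ [t] := by
  rcases List.eq_nil_or_concat (word b x) with h | ⟨L, u, h⟩
  · right
    rw [word_eq_nil] at h
    rw [h, one_mul, word_one, ← eval_singleton, word_eval FreeGroup.IsReduced.singleton]
    rfl
  · have hx : x = eval b (L ++ [u]) := by rw [← List.concat_eq_append, ← h, eval_word]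
    have hr : FreeGroup.IsReduced (L ++ [u]) := by
      rw [← List.concat_eq_append, ← h]; exact isReduced_word b x
    by_cases hu : u = bar t
    · left
      have : x * letter b t = eval b L := by
        rw [hx, hu, eval_append, eval_singleton, letter_bar, inv_mul_cancel_right]
      rw [this, word_eval (hr.infix ⟨[], [u], by simp⟩), h, hu, List.concat_eq_append]
    · right
      have h2 : FreeGroup.IsReduced (L ++ [u] ++ [t]) := by
        rw [FreeGroup.IsReduced, List.isChain_append]
        refine ⟨hr, by simp, ?_⟩
        simp only [List.getLast?_append, List.getLast?_singleton, Option.some_or, Option.mem_def,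
          Option.some.injEq, List.head?_cons]
        rintro _ rfl _ rfl h1
        by_contra h2
        exact hu (Prod.ext h1 (by
          change u.2 = !t.2
          revert h2
          cases u.2 <;> cases t.2 <;> simp))
      rw [h, List.concat_eq_append, ← word_eval (b := b) h2, eval_append b (L ++ [u]), ← hx]
      rfl

theorem word_letter_mul (x : F) (s : ι × Bool) :
    word b x = bar s :: word b (letter b s * x) ∨ word b (letter b s * x) = s :: word b x := by
  have h := word_mul_letter b x⁻¹ (bar s)
  rw [letter_bar b s, ← mul_inv_rev, word_inv, word_inv] at h
  have e : ∀ L : List (ι × Bool), ∀ t, FreeGroup.invRev (FreeGroup.invRev L ++ [t]) = bar t :: L := by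
    intro L t
    rw [FreeGroup.invRev_append, FreeGroup.invRev_invRev]
    simp [FreeGroup.invRev]
  rcases h with h | h
  · left
    have := congrArg FreeGroup.invRev h
    rwa [e, FreeGroup.invRev_invRev, bar_bar] at this
  · right
    have := congrArg FreeGroup.invRev h
    rwa [e, FreeGroup.invRev_invRev, bar_bar] at this

theorem closure_range_basis : Subgroup.closure (range b) = ⊤ := by
  rw [eq_top_iff]
  rintro x -
  rw [← eval_word b x]
  generalize word b x = L
  induction L with
  | nil => rw [eval_nil]; exact one_mem _
  | cons s L ih =>
    rw [eval_cons]
    refine mul_mem ?_ ih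
    obtain ⟨i, hi | hi⟩ := letter_eq (b := b) s
    · rw [hi]; exact Subgroup.subset_closure ⟨i, rfl⟩
    · rw [hi]; exact inv_mem (Subgroup.subset_closure ⟨i, rfl⟩)

/-- The half-tree of the elements whose reduced word begins with a given letter. -/
def half (s : ι × Bool) : Set F := {x | (word b x).head? = some s}

theorem mem_half {s : ι × Bool} {x : F} : x ∈ half b s ↔ (word b x).head? = some s := Iff.rfl

theorem one_notMem_half (s : ι × Bool) : (1 : F) ∉ half b s := by simp [mem_half, word_one]

theorem letter_mem_half (s : ι × Bool) : letter b s ∈ half b s := by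
  rw [mem_half, ← eval_singleton, word_eval FreeGroup.IsReduced.singleton]
  rfl

theorem exists_mem_half {x : F} (hx : x ≠ 1) : ∃ s, x ∈ half b s := by
  have : word b x ≠ [] := mt (word_eq_nil b).1 hx
  exact ⟨_, List.head?_eq_some_head this⟩

theorem half_disjoint {s t : ι × Bool} {x : F} (hs : x ∈ half b s) (ht : x ∈ half b t) : s = t :=
  Option.some.inj (hs.symm.trans ht)

theorem letter_mul_mem_half (s : ι × Bool) (x : F) :
    letter b s * x ∈ half b s ↔ x ∉ half b (bar s) := by
  rcases word_letter_mul b x s with h | h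
  · have h1 : x ∈ half b (bar s) := by rw [mem_half, h]; rfl
    refine iff_of_false (fun h2 => ?_) (fun h2 => h2 h1)
    have h3 := isReduced_word b x
    rw [h] at h3
    rw [mem_half] at h2
    revert h2 h3
    generalize word b (letter b s * x) = M
    intro h2 h3
    cases M with
    | nil => simp at h2
    | cons u M =>
      simp only [List.head?_cons, Option.some.injEq] at h2
      subst h2
      simp [FreeGroup.IsReduced, bar] at h3
  · refine iff_of_true (by rw [mem_half, h]; rfl) fun h2 => ?_
    have h3 := isReduced_word b (letter b s * x)
    rw [mem_half] at h2
    rw [h] at h3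
    revert h2 h3
    generalize word b x = M
    intro h2 h3
    cases M with
    | nil => simp at h2
    | cons u M =>
      simp only [List.head?_cons, Option.some.injEq] at h2
      subst h2
      simp [FreeGroup.IsReduced, bar] at h3

theorem half_eq_compl (s : ι × Bool) : half b s = (letter b s • half b (bar s))ᶜ := by
  ext x
  rw [mem_compl_iff, Set.mem_smul_set_iff_inv_smul_mem, ← letter_mul_mem_half, smul_eq_mul,
    mul_inv_cancel_left]

theorem head_word_mul_letter {x : F} {t : ι × Bool} (hx : x ≠ 1) (hxt : x * letter b t ≠ 1) :
    (word b (x * letter b t)).head? = (word b x).head? := by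
  rcases word_mul_letter b x t with h | h
  · rw [h, List.head?_append_of_ne_nil _ (mt (word_eq_nil b).1 hxt)]
  · rw [h, List.head?_append_of_ne_nil _ (mt (word_eq_nil b).1 hx)]

/-- Right multiplication by a letter acts at the end of the reduced word, so the first letter can
change only when one of the two words is empty. -/
theorem almostInvariant_half (s : ι × Bool) : AlmostInvariant (half b s) := by
  refine almostInvariant_of_closure _ (closure_range_basis b) ?_
  rintro _ ⟨i, rfl⟩
  refine (Set.toFinite {1, (b i)⁻¹}).subset fun x hx => ?_
  by_contra h
  simp only [mem_insert_iff, mem_singleton_iff, not_or, eq_inv_iff_mul_eq_one] at h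
  refine hx ?_
  rw [mem_half, mem_half, ← letter_true, head_word_mul_letter b h.1 h.2]

theorem eval_pow (L : List (ι × Bool)) (n : ℕ) :
    eval b L ^ n = eval b (List.replicate n L).flatten := by
  induction n with
  | zero => simp [eval_nil]
  | succ n ih => rw [pow_succ', ih, List.replicate_succ, List.flatten_cons, eval_append]

variable {b} in
theorem eval_pow_mem_half {L : List (ι × Bool)} (hL : FreeGroup.IsCyclicallyReduced L)
    {q : ι × Bool} (hq : L.head? = some q) {n : ℕ} (hn : n ≠ 0) : eval b L ^ n ∈ half b q := by
  rw [eval_pow, mem_half, word_eval (hL.flatten_replicate n).isReduced,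
    List.head?_flatten_replicate hn, hq]

theorem head?_invRev (L : List (ι × Bool)) : (FreeGroup.invRev L).head? = L.getLast?.map bar := by
  simp [FreeGroup.invRev]

variable {b} in
theorem eval_inv_pow_mem_half {L : List (ι × Bool)} (hL : FreeGroup.IsCyclicallyReduced L)
    {p : ι × Bool} (hp : L.getLast? = some p) {n : ℕ} (hn : n ≠ 0) :
    (eval b L)⁻¹ ^ n ∈ half b (bar p) := by
  rw [inv_pow, eval_pow, mem_half, word_inv, word_eval (hL.flatten_replicate n).isReduced,
    head?_invRev, List.getLast?_flatten_replicate hn, hp]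
  rfl

end Words

/-! ### Separating the axis of an element from a free factor system -/

section Separation

open Filter

variable {F ι : Type*} [Group F]

/-- Spell `k` in `T` and walk from `z` to `z * k`; membership in `X` changes at some step, and an
inverse generator is read backwards. -/
theorem exists_mul_generator_crossing {T : Set F} {X : Set F} {z k : F}
    (hk : k ∈ Subgroup.closure T) (h1 : z ∈ X) (h2 : z * k ∉ X) :
    ∃ z', z⁻¹ * z' ∈ Subgroup.closure T ∧ ∃ t ∈ T, ¬(z' ∈ X ↔ z' * t ∈ X) := by
  by_contra! h
  have : ∀ k ∈ Subgroup.closure T, ∀ z', z⁻¹ * z' ∈ Subgroup.closure T →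
      (z' ∈ X ↔ z' * k ∈ X) := by
    intro k hk
    induction hk using Subgroup.closure_induction with
    | mem t ht => exact fun z' hz' => h z' hz' t ht
    | one => simp
    | mul s t hs ht ih1 ih2 =>
      intro z' hz'
      rw [ih1 z' hz', ← mul_assoc]
      exact ih2 _ (by rw [← mul_assoc]; exact mul_mem hz' hs)
    | inv s hs ih =>
      intro z' hz'
      rw [ih (z' * s⁻¹) (by rw [← mul_assoc]; exact mul_mem hz' (inv_mem hs)),
        inv_mul_cancel_right]
  exact h2 ((this k hk z (by simp)).1 h1)

variable (b : FreeGroupBasis ι F)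

theorem exists_conj_cyclicallyReduced {a : F} (ha : a ≠ 1) :
    ∃ (c : F) (L : List (ι × Bool)), L ≠ [] ∧ FreeGroup.IsCyclicallyReduced L ∧
      a = c * eval b L * c⁻¹ := by
  classical
  set u := word b a
  have h := FreeGroup.reduceCyclically.conj_conjugator_reduceCyclically u
  have h2 : a = eval b (FreeGroup.reduceCyclically.conjugator u) *
      eval b (FreeGroup.reduceCyclically u) *
      (eval b (FreeGroup.reduceCyclically.conjugator u))⁻¹ := by
    rw [← eval_invRev, ← eval_append, ← eval_append, h, eval_word]
  refine ⟨_, _, fun h0 => ha ?_, FreeGroup.reduceCyclically.isCyclicallyReduced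
    (isReduced_word b a), h2⟩
  rw [h2, h0, eval_nil]
  simp

/-- The axis of an element that is not carried by `A` can be separated from the axes of the
elements of the factors of `A`. -/
theorem exists_separating_sets [Finite ι] (b : FreeGroupBasis ι F) (A : FreeFactorSystem F) {a : F} (ha1 : a ≠ 1)
    (ha : ¬ A.Carries a) :
    ∃ U V : Set F, AlmostInvariant U ∧ AlmostInvariant V ∧ Disjoint U V ∧ Connects a U V ∧
      ∀ i, ∀ x ∈ A.factor i, ¬ Connects x U V := by
  have := isMulTorsionFree_of_basis b
  obtain ⟨c, L, hL0, hL, hac⟩ := exists_conj_cyclicallyReduced b ha1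
  set w := eval b L with hw
  obtain ⟨q, hq⟩ : ∃ q, L.head? = some q := ⟨_, List.head?_eq_some_head hL0⟩
  obtain ⟨p, hp⟩ : ∃ p, L.getLast? = some p := ⟨_, List.getLast?_eq_some_getLast hL0⟩
  set X := half b q with hX
  have hpq : bar p ≠ q := by
    intro h
    have := hL.2 p hp q hq
    rw [← h] at this
    simp at this
  -- `L` may be followed by `q` because it is cyclically reduced. Hence the sets `w ^ n • X` are
  -- nested along the axis of `w`.
  have hwX : ∀ x ∈ X, w * x ∈ X := by
    intro x hx
    have hr : FreeGroup.IsReduced (L ++ word b x) := by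
      rw [FreeGroup.IsReduced, List.isChain_append]
      refine ⟨hL.1, isReduced_word b x, fun s hs t ht => ?_⟩
      rw [hX, mem_half] at hx
      have : t = q := Option.some.inj (ht.symm.trans hx)
      subst this
      exact hL.2 s hs t hq
    have : w * x = eval b (L ++ word b x) := by rw [eval_append, eval_word]
    rw [this, hX, mem_half, word_eval hr, List.head?_append_of_ne_nil _ hL0, hq]
  have hwpow : ∀ (n : ℕ), ∀ x ∈ X, w ^ n * x ∈ X := by
    intro n x hx
    induction n with
    | zero => simpa using hx
    | succ n ih => rw [pow_succ', mul_assoc]; exact hwX _ ih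
  have hsub : ∀ m n : ℕ, m ≤ n → w ^ n • X ⊆ w ^ m • X := by
    intro m n hmn x hx
    rw [Set.mem_smul_set_iff_inv_smul_mem, smul_eq_mul] at hx ⊢
    have := hwpow (n - m) _ hx
    convert this using 1
    rw [← mul_assoc]
    congr 1
    rw [eq_mul_inv_iff_mul_eq, inv_mul_eq_iff_eq_mul, ← pow_add]
    congr 1
    omega
  choose T hTfin hT using fun i => A.exists_generators b i
  let Φ : Set F := ⋃ i, ⋃ t ∈ T i, {x | ¬(x ∈ X ↔ x * t ∈ X)}
  have hΦ : Φ.Finite := finite_iUnion fun i => (hTfin i).biUnion fun t _ =>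
    almostInvariant_half b q t
  -- Only `M > |Φ|` matters, for the pigeonhole principle below.
  set M := hΦ.toFinset.card * (A.k + 1) + 1 with hM
  have hwinf : ∀ m n : ℕ, w ^ m = w ^ n → m = n := by
    intro m n hmn
    refine injective_mul_pow (y := w) (fun h1 => ha1 ?_) 1 (by simpa using hmn)
    rw [hac, h1]; simp
  refine ⟨w ^ M • X, Xᶜ, (almostInvariant_half b q).smul _, (almostInvariant_half b q).compl,
    ?_, ?_, ?_⟩
  · rw [Set.disjoint_compl_right_iff_subset]
    simpa using hsub 0 M (Nat.zero_le _)
  · have hw1 : w ≠ 1 := fun h => ha1 (by rw [hac, h]; simp)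
    have : Connects w (w ^ M • X) Xᶜ := by
      refine ⟨1, ?_, ?_⟩
      · refine eventually_atTop.2 ⟨M + 1, fun n hn => ?_⟩
        rw [Set.mem_smul_set_iff_inv_smul_mem, smul_eq_mul, one_mul]
        have : (w ^ M)⁻¹ * w ^ n = w ^ (n - M) := by
          rw [inv_mul_eq_iff_eq_mul, ← pow_add]
          congr 1
          omega
        rw [this]
        exact eval_pow_mem_half hL hq (by omega)
      · refine eventually_atTop.2 ⟨1, fun n hn => ?_⟩
        rw [one_mul]
        exact fun h => hpq (half_disjoint b (eval_inv_pow_mem_half hL hp (by omega)) h)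
    have := this.conj hw1 ((almostInvariant_half b q).smul _) (almostInvariant_half b q).compl c
    rwa [← hac] at this
  · rintro i x hx ⟨g, h1, h2⟩
    apply ha
    obtain ⟨n₁, hn₁⟩ := h1.exists
    obtain ⟨n₂, hn₂⟩ := h2.exists
    -- Two points of the coset `g A_i` lie in `w ^ M • X` and outside of `X`, hence on different
    -- sides of every intermediate `w ^ j • X`. A path in the coset crosses each of these, and
    -- translation by `w ^ (-j)` brings the crossing into `Φ`.
    have key : ∀ j : Fin M, ∃ z, g⁻¹ * z ∈ A.factor i ∧ (w ^ (j : ℕ))⁻¹ * z ∈ Φ := by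
      intro j
      have hk : (x ^ n₁)⁻¹ * x⁻¹ ^ n₂ ∈ A.factor i :=
        mul_mem (inv_mem (pow_mem hx _)) (pow_mem (inv_mem hx) _)
      have hz1 := hsub j M j.2.le hn₁
      have hz2 : g * x ^ n₁ * ((x ^ n₁)⁻¹ * x⁻¹ ^ n₂) ∉ w ^ (j : ℕ) • X := by
        rw [← mul_assoc, mul_inv_cancel_right]
        exact fun h => hn₂ (by simpa using hsub 0 j (Nat.zero_le _) h)
      obtain ⟨z, hz, t, ht, hzt⟩ := exists_mul_generator_crossing (T := T i)
        (by rw [hT]; exact hk) hz1 hz2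
      refine ⟨z, ?_, mem_iUnion.2 ⟨i, mem_iUnion₂.2 ⟨t, ht, ?_⟩⟩⟩
      · rw [hT] at hz
        have := mul_mem (pow_mem hx n₁) hz
        convert this using 1
        group
      · simpa only [mem_ofPred_eq, Set.mem_smul_set_iff_inv_smul_mem, smul_eq_mul,
          mul_assoc] using hzt
    choose z hz1 hz2 using key
    have hcard : hΦ.toFinset.card < Fintype.card (Fin M) := by
      rw [Fintype.card_fin, hM]
      nlinarith [Nat.zero_le (hΦ.toFinset.card * A.k)]
    obtain ⟨j, j', hjj, he⟩ : ∃ j j' : Fin M, j ≠ j' ∧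
        (w ^ (j : ℕ))⁻¹ * z j = (w ^ (j' : ℕ))⁻¹ * z j' := by
      obtain ⟨j, -, j', -, h, h'⟩ := Finset.exists_ne_map_eq_of_card_lt_of_maps_to
        (s := Finset.univ) (t := hΦ.toFinset) (f := fun j : Fin M => (w ^ (j : ℕ))⁻¹ * z j)
        (by simpa using hcard) (fun j _ => by simpa using hz2 j)
      exact ⟨j, j', h, h'⟩
    wlog hlt : (j : ℕ) < j' generalizing j j'
    · exact this j' j hjj.symm he.symm
        (lt_of_le_of_ne (not_lt.1 hlt) fun h => hjj (Fin.ext h.symm))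
    set r := (w ^ (j : ℕ))⁻¹ * z j with hr
    -- This element is `(z j)⁻¹ * z j'`, a quotient of two points of the coset `g A_i`.
    have hmem : (r⁻¹ * w * r) ^ ((j' : ℕ) - j) ∈ A.factor i := by
      have e1 : z j = w ^ (j : ℕ) * r := by rw [hr]; group
      have e2 : z j' = w ^ (j' : ℕ) * r := by rw [he]; group
      have h3 := mul_mem (inv_mem (hz1 j)) (hz1 j')
      have h4 : (r⁻¹ * w * r) ^ ((j' : ℕ) - j) = r⁻¹ * w ^ ((j' : ℕ) - j) * r := by
        have := conj_pow (a := r⁻¹) (b := w) (i := (j' : ℕ) - j)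
        rwa [inv_inv] at this
      have h5 : w ^ (j' : ℕ) = w ^ (j : ℕ) * w ^ ((j' : ℕ) - j) := by
        rw [← pow_add]; congr 1; omega
      rw [h4]
      convert h3 using 1
      rw [e1, e2, h5]
      group
    obtain ⟨ρ, hρ1, hρ2⟩ := A.exists_retraction i
    have h6 := hρ2 _ hmem
    rw [map_pow] at h6
    -- Roots are unique in `F`, so a retraction that fixes a power fixes its root.
    have h7 : ρ (r⁻¹ * w * r) = r⁻¹ * w * r := pow_left_injective (by omega) h6
    refine ⟨i, r⁻¹ * c⁻¹, ?_⟩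
    have h8 := hρ1 (r⁻¹ * w * r)
    rw [h7] at h8
    convert h8 using 1
    rw [hac]
    group

end Separation

/-! ### The topology of the double boundary -/

section Geodesics

variable {F ι : Type*} [Group F] {b : FreeGroupBasis ι F}

theorem IsGeodesic.shift {γ : ℤ → F} (h : IsGeodesic b γ) (k : ℤ) :
    IsGeodesic b fun n => γ (n + k) where
  adj n := by
    have := h.adj (n + k)
    rwa [add_right_comm] at this
  not_backtrack n := by
    have := h.not_backtrack (n + k)
    rwa [add_right_comm] at this

theorem IsGeodesic.reverse {γ : ℤ → F} (h : IsGeodesic b γ) : IsGeodesic b fun n => γ (-n) where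
  adj n := by
    obtain ⟨i, hi⟩ := h.adj (-(n + 1))
    rw [show -(n + 1) + 1 = -n by ring] at hi
    refine ⟨i, ?_⟩
    rw [← mul_inv_eq_iff_eq_mul, ← mul_inv_eq_iff_eq_mul, inv_inv] at hi
    exact hi.symm.imp Eq.symm Eq.symm
  not_backtrack n hn := h.not_backtrack (-(n + 2)) (by
    rw [show -(n + 2) + 2 = -n by ring]; exact hn.symm)

theorem range_reverse {α : Type*} (γ : ℤ → α) : range (fun n => γ (-n)) = range γ :=
  (Equiv.neg ℤ).surjective.range_comp γ

theorem range_shift {α : Type*} (γ : ℤ → α) (k : ℤ) : range (fun n => γ (n + k)) = range γ :=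
  (Equiv.addRight k).surjective.range_comp γ

theorem IsGeodesic.exists_letters {γ : ℤ → F} (h : IsGeodesic b γ) :
    ∃ s : ℤ → ι × Bool, (∀ n, γ (n + 1) = γ n * letter b (s n)) ∧ ∀ n, s (n + 1) ≠ bar (s n) := by
  have : ∀ n, ∃ s, γ (n + 1) = γ n * letter b s := by
    intro n
    obtain ⟨i, hi | hi⟩ := h.adj n
    · exact ⟨(i, true), hi⟩
    · refine ⟨bar (i, true), ?_⟩
      rw [letter_bar, letter_true, hi]
  choose s hs using this
  refine ⟨s, hs, fun n hn => h.not_backtrack n ?_⟩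
  rw [show n + 2 = n + 1 + 1 by ring, hs, hs, hn, letter_bar, mul_inv_cancel_right]

/-- A geodesic from `γ m` to `γ (m + k)` spells the reduced word of `(γ m)⁻¹ * γ (m + k)`. -/
theorem IsGeodesic.word_eq {γ : ℤ → F} (h : IsGeodesic b γ) (m : ℤ) (k : ℕ) :
    (word b ((γ m)⁻¹ * γ (m + k))).length = k ∧
      ∀ j ≤ k, γ (m + j) = γ m * eval b ((word b ((γ m)⁻¹ * γ (m + k))).take j) := by
  obtain ⟨s, hs, hs'⟩ := h.exists_letters
  let W : ℕ → List (ι × Bool) := fun k => (List.range k).map fun i : ℕ => s (m + i)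
  have hW : ∀ k : ℕ, γ (m + k) = γ m * eval b (W k) := by
    intro k
    induction k with
    | zero => simp [W, eval_nil]
    | succ k ih =>
      have : m + ((k + 1 : ℕ) : ℤ) = m + k + 1 := by push_cast; ring
      rw [this, hs, ih]
      simp only [W, List.range_succ, List.map_append, List.map_cons, List.map_nil, eval_append,
        eval_singleton, mul_assoc]
  have hred : FreeGroup.IsReduced (W k) := by
    rw [FreeGroup.IsReduced, List.isChain_iff_getElem]
    intro i hi h1
    simp only [W, List.getElem_map, List.getElem_range] at h1 ⊢
    have := hs' (m + i)
    rw [show m + (i : ℤ) + 1 = m + ((i + 1 : ℕ) : ℤ) by push_cast; ring] at this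
    by_contra h2
    apply this
    refine Prod.ext h1.symm ?_
    change _ = !_
    revert h2
    cases (s (m + i)).2 <;> cases (s (m + ((i + 1 : ℕ) : ℤ))).2 <;> simp
  have hword : word b ((γ m)⁻¹ * γ (m + k)) = W k := by
    rw [hW k, inv_mul_cancel_left, word_eval hred]
  rw [hword]
  refine ⟨by simp [W], fun j hj => ?_⟩
  rw [hW j]
  simp only [W, ← List.map_take, List.take_range, min_eq_left hj]

theorem IsGeodesic.injective {γ : ℤ → F} (h : IsGeodesic b γ) : Function.Injective γ := by
  intro m n hmn
  wlog hle : m ≤ n generalizing m n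
  · exact (this hmn.symm (le_of_not_ge hle)).symm
  obtain ⟨k, rfl⟩ := Int.exists_add_of_le hle
  have := (h.word_eq m k).1
  rw [← hmn, inv_mul_cancel, word_one] at this
  simp only [List.length_nil] at this
  simp [← this]

/-- A line through two points of a geodesic can be parametrized so that it agrees with this
geodesic between the two points. -/
theorem Line.exists_param {γ : ℤ → F} (h : IsGeodesic b γ) (N : ℕ) {L : Line b}
    (h1 : γ (-N) ∈ L.verts) (h2 : γ N ∈ L.verts) :
    ∃ γ', IsGeodesic b γ' ∧ range γ' = L.verts ∧ ∀ j : ℤ, -N ≤ j → j ≤ N → γ' j = γ j := by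
  obtain ⟨δ, hδ, hL⟩ := L.2
  change range δ = L.verts at hL
  rw [← hL] at h1 h2
  obtain ⟨m, hm⟩ := h1
  obtain ⟨n, hn⟩ := h2
  wlog hle : m ≤ n generalizing δ m n
  · refine this _ hδ.reverse ((range_reverse δ).trans hL) (-m) ?_ (-n) ?_ (by omega)
    · simpa using hm
    · simpa using hn
  obtain ⟨k, rfl⟩ := Int.exists_add_of_le hle
  have e1 := hδ.word_eq m k
  have e2 := h.word_eq (-N) (2 * N)
  rw [show (-N : ℤ) + (2 * N : ℕ) = N by push_cast; ring, ← hm, ← hn] at e2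
  have hk : k = 2 * N := e1.1.symm.trans e2.1
  refine ⟨fun j => δ (j + (m + N)), hδ.shift _, (range_shift δ _).trans hL, fun j hj1 hj2 => ?_⟩
  obtain ⟨i, hi⟩ := Int.exists_add_of_le hj1
  have hik : i ≤ 2 * N := by omega
  rw [hi, e2.2 i hik, ← e1.2 i (hk ▸ hik)]
  change δ _ = δ _
  congr 1
  ring

theorem finite_ball [Finite ι] (b : FreeGroupBasis ι F) (v : F) (k : ℕ) :
    {x | (word b (v⁻¹ * x)).length ≤ k}.Finite := by
  refine ((List.finite_length_le (ι × Bool) k).image fun L => v * eval b L).subset fun x hx => ?_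
  exact ⟨_, hx, by simp only [eval_word, mul_inv_cancel_left]⟩

end Geodesics

/-! ### Compact open sets of lines -/

section Topology

variable {F ι : Type*} [Group F] (b : FreeGroupBasis ι F)

theorem isOpen_cylinder (g h : F) : IsOpen (cylinder b g h) :=
  TopologicalSpace.isOpen_generateFrom_of_mem ⟨g, h, rfl⟩

/-- Geodesics parametrized so that `γ 0 = v` form a closed subset of a product of finite balls,
which is compact by Tychonoff's theorem; the cylinder is its continuous image. -/
theorem isCompact_cylinder [Finite ι] (v : F) : IsCompact (cylinder b v v) := by
  let _ : TopologicalSpace F := ⊥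
  have : DiscreteTopology F := ⟨rfl⟩
  let P : Set (ℤ → F) := {γ | IsGeodesic b γ ∧ γ 0 = v}
  have hclosed : IsClosed P := by
    have : P = (⋂ n, (fun γ : ℤ → F => (γ n, γ (n + 1))) ⁻¹'
          {p | ∃ i, p.2 = p.1 * b i ∨ p.2 = p.1 * (b i)⁻¹}) ∩
        (⋂ n, (fun γ : ℤ → F => (γ n, γ (n + 2))) ⁻¹' {p | p.2 ≠ p.1}) ∩
        (fun γ : ℤ → F => γ 0) ⁻¹' {v} := by
      ext γ
      simp only [P, mem_ofPred_eq, mem_inter_iff, mem_iInter, mem_preimage, mem_singleton_iff]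
      exact ⟨fun h => ⟨⟨h.1.adj, h.1.not_backtrack⟩, h.2⟩, fun h => ⟨⟨h.1.1, h.1.2⟩, h.2⟩⟩
    rw [this]
    refine (IsClosed.inter ?_ ?_).inter ?_
    · exact isClosed_iInter fun n => (isClosed_discrete _).preimage (by fun_prop)
    · exact isClosed_iInter fun n => (isClosed_discrete _).preimage (by fun_prop)
    · exact (isClosed_discrete _).preimage (by fun_prop)
  have hcpt : IsCompact P := by
    refine (isCompact_univ_pi fun n : ℤ =>
      (finite_ball b v n.natAbs).isCompact).of_isClosed_subset hclosed ?_
    rintro γ ⟨hγ, rfl⟩ n -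
    change (word b ((γ 0)⁻¹ * γ n)).length ≤ n.natAbs
    rcases Int.natAbs_eq n with h | h
    · have := (hγ.word_eq 0 n.natAbs).1
      rw [zero_add, ← h] at this
      exact this.le
    · have := (hγ.reverse.word_eq 0 n.natAbs).1
      rw [zero_add, ← h] at this
      exact this.le
  let f : P → Line b := fun γ => ⟨range γ.1, γ.1, γ.2.1, rfl⟩
  have hf : Continuous f := by
    refine continuous_generateFrom_iff.2 ?_
    rintro _ ⟨g, h, rfl⟩
    have : f ⁻¹' cylinder b g h = (⋃ n, (fun γ : P => γ.1 n) ⁻¹' {g}) ∩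
        ⋃ n, (fun γ : P => γ.1 n) ⁻¹' {h} := by
      ext γ
      simp only [mem_inter_iff, mem_iUnion, mem_preimage, mem_singleton_iff]
      rfl
    rw [this]
    refine IsOpen.inter ?_ ?_ <;>
    exact isOpen_iUnion fun n =>
      (isOpen_discrete _).preimage ((continuous_apply n).comp continuous_subtype_val)
  have := isCompact_iff_compactSpace.1 hcpt
  convert isCompact_range hf using 1
  ext L
  constructor
  · rintro ⟨hv, -⟩
    obtain ⟨γ, hγ, hL⟩ := L.2
    change range γ = L.verts at hL
    rw [← hL] at hv
    obtain ⟨m, hm⟩ := hv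
    refine ⟨⟨fun n => γ (n + m), hγ.shift m, by simpa using hm⟩, Line.ext' ?_⟩
    exact (range_shift γ m).trans hL
  · rintro ⟨γ, rfl⟩
    have : v ∈ (f γ).verts := ⟨0, γ.2.2⟩
    exact ⟨this, this⟩

/-- The lines with an end in `U`. -/
def linesInto (U : Set F) : Set (Line b) := {L | (L.verts ∩ U).Infinite}

variable {b}

/-- The coboundary of a set of vertices. -/
def coboundary (b : FreeGroupBasis ι F) (U : Set F) : Set F :=
  ⋃ s, {x | ¬(x ∈ U ↔ x * letter b s ∈ U)}

theorem AlmostInvariant.finite_coboundary [Finite ι] {U : Set F} (hU : AlmostInvariant U) :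
    (coboundary b U).Finite := finite_iUnion fun _ => hU _

theorem IsGeodesic.mem_iff_of_notMem_coboundary {γ : ℤ → F} (h : IsGeodesic b γ) {U : Set F}
    {n : ℤ} (hn : γ n ∉ coboundary b U) : γ (n + 1) ∈ U ↔ γ n ∈ U := by
  obtain ⟨s, hs, -⟩ := h.exists_letters
  simp only [coboundary, mem_iUnion, not_exists, mem_ofPred_eq, not_not] at hn
  rw [hs, ← hn]

theorem IsGeodesic.mem_iff_of_le {γ : ℤ → F} (h : IsGeodesic b γ) {U : Set F} {N : ℕ}
    (hN : ∀ x ∈ coboundary b U, (word b ((γ 0)⁻¹ * x)).length < N) (n : ℕ) (hn : N ≤ n) :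
    γ n ∈ U ↔ γ N ∈ U := by
  induction n, hn using Nat.le_induction with
  | base => rfl
  | succ n hn ih =>
    rw [← ih]
    push_cast
    refine h.mem_iff_of_notMem_coboundary fun hx => ?_
    have h1 := hN _ hx
    have h2 := (h.word_eq 0 n).1
    rw [zero_add] at h2
    omega

theorem IsGeodesic.infinite_iff {γ : ℤ → F} (h : IsGeodesic b γ) {U : Set F} {N : ℕ}
    (hN : ∀ x ∈ coboundary b U, (word b ((γ 0)⁻¹ * x)).length < N) :
    (range γ ∩ U).Infinite ↔ γ N ∈ U ∨ γ (-N) ∈ U := by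
  have hp := h.mem_iff_of_le hN
  have hm := h.reverse.mem_iff_of_le hN
  constructor
  · intro hinf
    by_contra! hc
    refine hinf (((finite_Ioo (-(N : ℤ)) N).image γ).subset ?_)
    rintro _ ⟨⟨n, rfl⟩, hn⟩
    refine ⟨n, ⟨?_, ?_⟩, rfl⟩
    · by_contra hlt
      obtain ⟨k, hk⟩ := Int.exists_add_of_le (show (0 : ℤ) ≤ -n by omega)
      have hk' : n = -(k : ℤ) := by omega
      rw [hk'] at hn
      exact hc.2 ((hm k (by omega)).1 hn)
    · by_contra hlt
      obtain ⟨k, hk⟩ := Int.exists_add_of_le (show (0 : ℤ) ≤ n by omega)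
      have hk' : n = (k : ℤ) := by omega
      rw [hk'] at hn
      exact hc.1 ((hp k (by omega)).1 hn)
  · rintro (h1 | h1)
    · refine infinite_of_injective_forall_mem (f := fun n : ℕ => γ ((N + n : ℕ) : ℤ)) ?_ ?_
      · intro m n hmn
        have := h.injective hmn
        omega
      · exact fun n => ⟨⟨_, rfl⟩, (hp _ (by omega)).2 h1⟩
    · refine infinite_of_injective_forall_mem (f := fun n : ℕ => γ (-((N + n : ℕ) : ℤ))) ?_ ?_
      · intro m n hmn
        have := h.injective hmn
        omega
      · exact fun n => ⟨⟨_, rfl⟩, (hm _ (by omega)).2 h1⟩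

/-- Once a geodesic has left a ball containing the coboundary of `U`, its membership in `U` is
constant. Whether it ends in `U` is therefore decided by a finite segment, and the lines crossing
this segment form a neighbourhood. -/
theorem AlmostInvariant.eventually_linesInto [Finite ι] {U : Set F} (hU : AlmostInvariant U)
    (L : Line b) :
    ∃ O : Set (Line b), IsOpen O ∧ L ∈ O ∧ ∀ L' ∈ O, L' ∈ linesInto b U ↔ L ∈ linesInto b U := by
  obtain ⟨γ, hγ, hL⟩ := L.2
  change range γ = L.verts at hL
  obtain ⟨N, hN⟩ : ∃ N : ℕ, ∀ x ∈ coboundary b U, (word b ((γ 0)⁻¹ * x)).length < N := by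
    obtain ⟨N, hN⟩ := (hU.finite_coboundary (b := b)).image
      (fun x => (word b ((γ 0)⁻¹ * x)).length) |>.bddAbove
    exact ⟨N + 1, fun x hx => Nat.lt_succ_of_le (hN ⟨x, hx, rfl⟩)⟩
  refine ⟨cylinder b (γ (-N)) (γ N), isOpen_cylinder b _ _, ?_, ?_⟩
  · constructor <;> rw [← hL] <;> exact mem_range_self _
  · rintro L' ⟨h1, h2⟩
    obtain ⟨γ', hγ', hL', he⟩ := Line.exists_param hγ N h1 h2
    have e0 := he 0 (by omega) (by omega)
    have e1 := he N (by omega) (by omega)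
    have e2 := he (-N) (by omega) (by omega)
    simp only [linesInto, mem_ofPred_eq]
    rw [← hL, ← hL', hγ.infinite_iff hN, hγ'.infinite_iff (N := N) (by rwa [e0]), e1, e2]

theorem AlmostInvariant.isClopen_linesInto [Finite ι] {U : Set F} (hU : AlmostInvariant U) :
    IsClopen (linesInto b U) := by
  refine ⟨⟨isOpen_iff_forall_mem_open.2 fun L hL => ?_⟩,
    isOpen_iff_forall_mem_open.2 fun L hL => ?_⟩
  · obtain ⟨O, h1, h2, h3⟩ := hU.eventually_linesInto L
    exact ⟨O, fun L' hL' => fun h => hL ((h3 L' hL').1 h), h1, h2⟩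
  · obtain ⟨O, h1, h2, h3⟩ := hU.eventually_linesInto L
    exact ⟨O, fun L' hL' => (h3 L' hL').2 hL, h1, h2⟩

variable (b) in
/-- The lines that lead from `U` to `V`. -/
def linesBetween (U V : Set F) : Set (Line b) := linesInto b U ∩ linesInto b V

/-- A line with points in both `U` and `V` passes through the finite coboundary of `U`, so these
lines form a closed subset of a finite union of compact cylinders. -/
theorem isCompact_linesBetween [Finite ι] {U V : Set F} (hU : AlmostInvariant U)
    (hV : AlmostInvariant V) (hUV : Disjoint U V) : IsCompact (linesBetween b U V) := by
  have hc : IsCompact (⋃ v ∈ coboundary b U, cylinder b v v) :=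
    (hU.finite_coboundary).isCompact_biUnion fun v _ => isCompact_cylinder b v
  refine hc.of_isClosed_subset (hU.isClopen_linesInto.1.inter hV.isClopen_linesInto.1) ?_
  rintro L ⟨h1, h2⟩
  obtain ⟨γ, hγ, hL⟩ := L.2
  change range γ = L.verts at hL
  simp only [linesInto, mem_ofPred_eq, ← hL] at h1 h2
  obtain ⟨_, ⟨m, rfl⟩, hm⟩ := h1.nonempty
  obtain ⟨_, ⟨n, rfl⟩, hn⟩ := h2.nonempty
  have hn' : γ n ∉ U := fun h => disjoint_left.1 hUV h hn
  by_contra hno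
  have hstep : ∀ k, γ (k + 1) ∈ U ↔ γ k ∈ U := fun k =>
    hγ.mem_iff_of_notMem_coboundary fun hk => hno (mem_iUnion₂.2 ⟨_, hk, by
      have : γ k ∈ L.verts := hL ▸ mem_range_self k
      exact ⟨this, this⟩⟩)
  have hall : ∀ k, γ k ∈ U := by
    intro k
    induction k using Int.inductionOn' (b := m) with
    | zero => exact hm
    | succ k _ ih => exact (hstep k).2 ih
    | pred k _ ih => exact (hstep (k - 1)).1 (by rwa [sub_add_cancel])
  exact hn' (hall n)

theorem isOpen_linesBetween [Finite ι] {U V : Set F} (hU : AlmostInvariant U)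
    (hV : AlmostInvariant V) : IsOpen (linesBetween b U V) :=
  hU.isClopen_linesInto.2.inter hV.isClopen_linesInto.2

/-- The axis is covered by finitely many sequences `y ^ m * γ r`, one for each residue `r` modulo
the translation length, all parallel to the powers of `y`. -/
theorem smul_axis_mem_linesInto {U : Set F} (hU : AlmostInvariant U) {y : F} (hy : y ≠ 1) (g : F) :
    g • axis b y hy ∈ linesInto b U ↔ EndsIn y g U ∨ EndsIn y⁻¹ g U := by
  have := isMulTorsionFree_of_basis b
  obtain ⟨γ, hγ, hL, l, hl, hγl⟩ := axis_spec b y hy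
  have hlz : ∀ (m : ℕ) n, γ (n + l * m) = y ^ m * γ n := by
    intro m
    induction m with
    | zero => simp
    | succ m ih =>
      intro n
      rw [show n + (l : ℤ) * ((m + 1 : ℕ) : ℤ) = (n + l * m) + l by push_cast; ring, hγl, ih,
        ← mul_assoc, ← pow_succ']
  have hlz' : ∀ (m : ℕ) n, γ (n - l * m) = y⁻¹ ^ m * γ n := by
    intro m n
    rw [inv_pow, eq_inv_mul_iff_mul_eq, ← hlz, sub_add_cancel]
  simp only [linesInto, mem_ofPred_eq, Line.verts_smul, ← hL]
  constructor
  · intro hinf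
    by_contra! hc
    have h1 := (hU.endsIn_or hy g).resolve_left hc.1
    have h2 := (hU.endsIn_or (inv_ne_one.2 hy) g).resolve_left hc.2
    have h3 : ∀ r : ℕ, ∃ N, ∀ n ≥ N, g * y ^ n * γ r ∉ U ∧ g * y⁻¹ ^ n * γ r ∉ U := fun r =>
      Filter.eventually_atTop.1 ((hU.compl.endsIn_mul_right hy h1 (γ r)).and
        (hU.compl.endsIn_mul_right (inv_ne_one.2 hy) h2 (γ r)))
    choose N hN using h3
    refine hinf ((finite_iUnion (ι := Fin l) fun r => ((finite_Iio (N r)).image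
      fun n => g * y ^ n * γ r).union ((finite_Iio (N r)).image
      fun n => g * y⁻¹ ^ n * γ r)).subset ?_)
    rintro _ ⟨⟨_, ⟨n, rfl⟩, rfl⟩, hx⟩
    simp only [smul_eq_mul] at hx ⊢
    have hlpos : (0 : ℤ) < l := by exact_mod_cast hl
    have h1 := Int.emod_nonneg n hlpos.ne'
    have h2 := Int.emod_lt_of_pos n hlpos
    have e := Int.emod_add_mul_ediv n l
    obtain ⟨r, hr⟩ := Int.eq_ofNat_of_zero_le h1
    refine mem_iUnion.2 ⟨⟨r, by omega⟩, ?_⟩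
    rw [hr] at e
    rcases Int.eq_nat_or_neg (n / l) with ⟨m, hm | hm⟩
    · left
      have hγn : γ n = y ^ m * γ r := by rw [← hlz, ← hm, e]
      rw [hγn] at hx ⊢
      refine ⟨m, ?_, mul_assoc _ _ _⟩
      by_contra hlt
      exact (hN r m (not_lt.1 hlt)).1 (by rwa [mul_assoc])
    · right
      have hγn : γ n = y⁻¹ ^ m * γ r := by
        rw [← hlz', ← e, hm]
        congr 1
        ring
      rw [hγn] at hx ⊢
      refine ⟨m, ?_, mul_assoc _ _ _⟩
      by_contra hlt
      exact (hN r m (not_lt.1 hlt)).2 (by rwa [mul_assoc])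
  · have hmain : ∀ z : F, z ≠ 1 → (∀ m : ℕ, z ^ m * γ 0 ∈ range γ) → EndsIn z g U →
        (g • range γ ∩ U).Infinite := by
      intro z hz hmem h
      obtain ⟨N, hN⟩ := Filter.eventually_atTop.1 (hU.endsIn_mul_right hz h (γ 0))
      refine infinite_of_injective_forall_mem (f := fun n : ℕ => g * z ^ (N + n) * γ 0) ?_ ?_
      · intro m n hmn
        have := injective_mul_pow hz g (mul_right_cancel hmn)
        omega
      · exact fun n => ⟨⟨_, hmem (N + n), by simp [mul_assoc]⟩, hN _ (by omega)⟩
    rintro (h | h)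
    · exact hmain y hy (fun m => ⟨_, hlz m 0⟩) h
    · exact hmain y⁻¹ (inv_ne_one.2 hy) (fun m => ⟨_, hlz' m 0⟩) h

theorem smul_axis_mem_linesBetween {U V : Set F} (hU : AlmostInvariant U)
    (hV : AlmostInvariant V) (hUV : Disjoint U V) {y : F} (hy : y ≠ 1) :
    (∃ g : F, g • axis b y hy ∈ linesBetween b U V) ↔ Connects y U V ∨ Connects y V U := by
  have hno : ∀ z g, EndsIn z g U → ¬EndsIn z g V := fun z g h1 h2 => by
    obtain ⟨x, hx⟩ := (h1.inter h2).nonempty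
    exact disjoint_left.1 hUV hx.1 hx.2
  simp only [linesBetween, mem_inter_iff, smul_axis_mem_linesInto hU, smul_axis_mem_linesInto hV]
  constructor
  · rintro ⟨g, h1 | h1, h2 | h2⟩
    · exact (hno _ _ h1 h2).elim
    · exact Or.inl ⟨g, h1, h2⟩
    · exact Or.inr ⟨g, h2, h1⟩
    · exact (hno _ _ h1 h2).elim
  · rintro (⟨g, h1, h2⟩ | ⟨g, h1, h2⟩)
    · exact ⟨g, Or.inl h1, Or.inr h2⟩
    · exact ⟨g, Or.inr h2, Or.inl h1⟩

/-- If no element of a factor of `A` connects `U` and `V`, then the lines between `U` and `V` form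
a compact open subset of `Y`, and rational currents are positive on this set if and only if the
element connects `U` and `V`. -/
theorem exists_compactOpens [Finite ι] (A : FreeFactorSystem F) {U V : Set F}
    (hU : AlmostInvariant U) (hV : AlmostInvariant V) (hUV : Disjoint U V)
    (hA : ∀ i, ∀ x ∈ A.factor i, ¬ Connects x U V) :
    ∃ C : TopologicalSpace.CompactOpens (Y b A), ∀ y, y ≠ 1 →
      ((rationalCurrent b A y).toFun C ≠ 0 ↔ Connects y U V ∨ Connects y V U) := by
  have hdisj : Disjoint (linesBetween b U V) (systemBoundary b A) := by
    rw [systemBoundary, disjoint_iUnion_right]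
    intro i
    -- Since the set of lines is open, it suffices to avoid the axes themselves rather than their
    -- closure.
    refine Disjoint.closure_right ?_ (isOpen_linesBetween hU hV)
    rw [disjoint_right]
    rintro _ ⟨x, hx, hx1, g, rfl⟩ hL
    rcases (smul_axis_mem_linesBetween hU hV hUV hx1).1 ⟨g, hL⟩ with h | h
    · exact hA i x hx h
    · exact hA i _ (inv_mem hx) h.symm
  have himage : Subtype.val '' (Subtype.val ⁻¹' linesBetween b U V : Set (Y b A)) =
      linesBetween b U V := by
    ext L
    constructor
    · rintro ⟨L, hL, rfl⟩
      exact hL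
    · exact fun hL => ⟨⟨L, disjoint_left.1 hdisj hL⟩, hL, rfl⟩
  let C : TopologicalSpace.CompactOpens (Y b A) :=
    ⟨⟨Subtype.val ⁻¹' linesBetween b U V, by
      refine Topology.IsInducing.subtypeVal.isCompact_iff.2 ?_
      exact himage.symm ▸ isCompact_linesBetween hU hV hUV⟩,
      (isOpen_linesBetween hU hV).preimage continuous_subtype_val⟩
  refine ⟨C, fun y hy => ?_⟩
  have hC : lines C = linesBetween b U V := himage
  rw [← smul_axis_mem_linesBetween (b := b) hU hV hUV hy]
  change ((liftCount y C : ℕ) : ℝ≥0) ≠ 0 ↔ _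
  rw [Nat.cast_ne_zero, liftCount, ← Nat.pos_iff_ne_zero, Set.ncard_pos (finite_lifts y C),
    image_nonempty]
  simp only [liftSet, hC]
  constructor
  · rintro ⟨g, _, hg⟩
    exact ⟨g, hg⟩
  · rintro ⟨g, hg⟩
    exact ⟨g, hy, hg⟩

end Topology

/-! ### Whitehead graphs without cut vertex -/

section Whitehead

/-- A graph is connected and stays connected if one vertex is deleted. -/
def NoCutVertex {α : Type*} (R : α → α → Prop) : Prop :=
  ∀ S : Set α, (S = univ ∨ ∃ z, S = {z}ᶜ) → ∀ P ⊆ S, P.Nonempty → (S \ P).Nonempty →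
    ∃ p ∈ P, ∃ q ∈ S \ P, R p q

theorem NoCutVertex.mono {α : Type*} {R R' : α → α → Prop} (h : NoCutVertex R)
    (hR : ∀ p q, p ≠ q → R p q → R' p q) : NoCutVertex R' := by
  intro S hS P hP h1 h2
  obtain ⟨p, hp, q, hq, hpq⟩ := h S hS P hP h1 h2
  exact ⟨p, hp, q, hq, hR p q (fun e => hq.2 (e ▸ hp)) hpq⟩

variable {F ι : Type*} [Group F] (b : FreeGroupBasis ι F)

/-- The Whitehead graph of a set of elements: two letters are joined if a translate of the axis of
one of the elements leads from one half-tree to the other. -/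
def Joined (T : Set F) (p q : ι × Bool) : Prop :=
  ∃ y ∈ T, y ≠ 1 ∧ (Connects y (half b p) (half b q) ∨ Connects y (half b q) (half b p))

/-- `X` is trivial on the half-tree `g • half b s`. -/
def TrivialOn (X : Set F) (g : F) (s : ι × Bool) : Prop :=
  (g • half b s ∩ X).Finite ∨ (g • half b s \ X).Finite

variable {b}

theorem Connects.of_finite [IsMulTorsionFree F] {X U V : Set F} {y u : F} (hy : y ≠ 1)
    (h : Connects y U V) (hU : (u • U \ X).Finite) (hV : (u • V ∩ X).Finite) :
    Connects y X Xᶜ := by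
  obtain ⟨g, h1, h2⟩ := h
  refine ⟨u * g, EndsIn.of_diff_finite hy (X := u • U) ?_ hU,
    EndsIn.of_diff_finite (inv_ne_one.2 hy) (X := u • V) ?_ (hV.subset fun x hx =>
      ⟨hx.1, not_not.1 hx.2⟩)⟩
  · rwa [endsIn_smul, inv_mul_cancel_left]
  · rwa [endsIn_smul, inv_mul_cancel_left]

/-- If some half-trees at `u` were almost contained in `X` and others almost disjoint from it,
connectivity of the graph on `S` would give an axis leading from one kind to the other, and this
axis would cross `X`. -/
theorem finite_of_forall_pure [Finite ι] {T X : Set F}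
    (hX : ∀ y ∈ T, y ≠ 1 → ¬ Connects y X Xᶜ ∧ ¬ Connects y Xᶜ X) (h : NoCutVertex (Joined b T))
    {S : Set (ι × Bool)} (hS : S = univ ∨ ∃ z, S = {z}ᶜ) {u : F} (hu : ∀ t ∈ S, TrivialOn b X u t) :
    ((⋃ t ∈ S, u • half b t) ∩ X).Finite ∨ ((⋃ t ∈ S, u • half b t) \ X).Finite := by
  have := isMulTorsionFree_of_basis b
  let P := {t ∈ S | (u • half b t \ X).Finite}
  rcases P.eq_empty_or_nonempty with hP | hP
  · left
    rw [iUnion₂_inter]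
    refine (toFinite S).biUnion fun t ht => (hu t ht).resolve_right fun h' => ?_
    exact (hP ▸ (⟨ht, h'⟩ : t ∈ P) : t ∈ (∅ : Set _))
  rcases (S \ P).eq_empty_or_nonempty with hQ | hQ
  · right
    refine ((toFinite S).biUnion fun t ht => (sdiff_eq_empty.1 hQ ht).2).subset ?_
    rintro x ⟨hx, hxX⟩
    obtain ⟨t, ht, hxt⟩ := mem_iUnion₂.1 hx
    exact mem_iUnion₂.2 ⟨t, ht, hxt, hxX⟩
  obtain ⟨p, hp, q, hq, y, hy, hy1, hpq⟩ := h S hS P (sep_subset _ _) hP hQ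
  have h2 : (u • half b q ∩ X).Finite := (hu q hq.1).resolve_right fun h' => hq.2 ⟨hq.1, h'⟩
  rcases hpq with hpq | hpq
  · exact ((hX y hy hy1).1 (hpq.of_finite hy1 hp.2 h2)).elim
  · refine ((hX y hy hy1).2 ?_).elim
    have := hpq.symm.of_finite (inv_ne_one.2 hy1) hp.2 h2
    simpa using this.symm

/-- Extensions of `L` stay outside the ball that contains the coboundary, so membership in `X` never
changes along them. -/
theorem mem_iff_of_prefix {X : Set F} {N : ℕ} (hN : ∀ x ∈ coboundary b X, (word b x).length < N)
    {L : List (ι × Bool)} (hL : N ≤ L.length) (M : List (ι × Bool))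
    (hM : FreeGroup.IsReduced (L ++ M)) : eval b (L ++ M) ∈ X ↔ eval b L ∈ X := by
  induction M using List.reverseRecOn with
  | nil => simp
  | append_singleton M r ih =>
    rw [← List.append_assoc] at hM ⊢
    have hM' := hM.infix (L₁ := L ++ M) ⟨[], [r], by simp⟩
    rw [← ih hM', eval_append b (L ++ M), eval_singleton]
    by_contra h
    have := hN (eval b (L ++ M)) (mem_iUnion.2 ⟨r, fun h' => h h'.symm⟩)
    rw [word_eval hM', List.length_append] at this
    omega

/-- Triviality of `X` spreads from distant half-trees towards the root. At each vertex on the way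
the direction back to the root is the deleted vertex of the Whitehead graph; at the root the whole
graph is used. -/
theorem finite_or_finite_of_noCutVertex [Finite ι] {T X : Set F} (hXai : AlmostInvariant X)
    (hX : ∀ y ∈ T, y ≠ 1 → ¬ Connects y X Xᶜ ∧ ¬ Connects y Xᶜ X)
    (h : NoCutVertex (Joined b T)) : X.Finite ∨ Xᶜ.Finite := by
  obtain ⟨N, hN⟩ : ∃ N : ℕ, ∀ x ∈ coboundary b X, (word b x).length < N := by
    obtain ⟨N, hN⟩ := (hXai.finite_coboundary (b := b)).image
      (fun x => (word b x).length) |>.bddAbove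
    exact ⟨N + 1, fun x hx => Nat.lt_succ_of_le (hN ⟨x, hx, rfl⟩)⟩
  -- `k` bounds how far the half-tree lies inside the ball of radius `N`; at `k = 0` it contains no
  -- coboundary that could separate its points.
  have key : ∀ (k : ℕ) (L : List (ι × Bool)) (s : ι × Bool), FreeGroup.IsReduced (L ++ [s]) →
      N ≤ k + (L ++ [s]).length → TrivialOn b X (eval b L) s := by
    intro k
    induction k with
    | zero =>
      intro L s hL hlen
      have hmem : ∀ x ∈ eval b L • half b s, x ∈ X ↔ eval b (L ++ [s]) ∈ X := by
        intro x hx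
        rw [Set.mem_smul_set_iff_inv_smul_mem, smul_eq_mul, mem_half] at hx
        obtain ⟨M, hM⟩ := List.head?_eq_some_iff.1 hx
        have hr := isReduced_word b ((eval b L)⁻¹ * x)
        rw [hM] at hr
        have hr' : FreeGroup.IsReduced (L ++ [s] ++ M) := hL.append_overlap hr (by simp)
        have hx' : x = eval b (L ++ [s] ++ M) := by
          rw [List.append_assoc, eval_append, List.singleton_append, ← hM, eval_word,
            mul_inv_cancel_left]
        rw [hx']
        exact mem_iff_of_prefix hN (by omega) M hr'
      by_cases hs : eval b (L ++ [s]) ∈ X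
      · right
        rw [sdiff_eq_empty.2 fun x hx => (hmem x hx).2 hs]
        exact finite_empty
      · left
        refine finite_empty.subset fun x hx => hs ((hmem x hx.1).1 hx.2)
    | succ k ih =>
      intro L s hL hlen
      have hpure := finite_of_forall_pure hX h (S := {bar s}ᶜ) (Or.inr ⟨_, rfl⟩)
        (u := eval b (L ++ [s])) (fun t ht => ih _ t ?_ (by
          simp only [List.length_append, List.length_singleton] at hlen ⊢
          omega))
      · have hsub : eval b L • half b s ⊆
            {eval b (L ++ [s])} ∪ ⋃ t ∈ ({bar s}ᶜ : Set _), eval b (L ++ [s]) • half b t := by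
          intro x hx
          rw [half_eq_compl, Set.smul_set_compl, smul_smul, ← eval_singleton, ← eval_append] at hx
          by_cases h1 : (eval b (L ++ [s]))⁻¹ * x = 1
          · left
            rw [inv_mul_eq_one] at h1
            exact h1.symm
          · right
            obtain ⟨t, ht⟩ := exists_mem_half b h1
            have ht' : x ∈ eval b (L ++ [s]) • half b t :=
              Set.mem_smul_set_iff_inv_smul_mem.2 ht
            exact mem_iUnion₂.2 ⟨t, fun e => hx (e ▸ ht'), ht'⟩
        rcases hpure with h1 | h1
        · left
          refine ((finite_singleton (eval b (L ++ [s]))).union h1).subset fun x hx => ?_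
          exact (hsub hx.1).imp id fun h' => ⟨h', hx.2⟩
        · right
          refine ((finite_singleton (eval b (L ++ [s]))).union h1).subset fun x hx => ?_
          exact (hsub hx.1).imp id fun h' => ⟨h', hx.2⟩
      · rw [FreeGroup.IsReduced, List.isChain_append]
        refine ⟨hL, by simp, ?_⟩
        simp only [List.getLast?_append, List.getLast?_singleton, Option.some_or, Option.mem_def,
          Option.some.injEq, List.head?_cons]
        rintro _ rfl _ rfl h1
        by_contra h2
        refine ht (Prod.ext h1.symm ?_)
        change t.2 = !s.2
        revert h2
        cases s.2 <;> cases t.2 <;> simp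
  have hroot := finite_of_forall_pure hX h (S := univ) (Or.inl rfl) (u := 1) fun t _ => by
    rw [← eval_nil b]
    exact key N [] t FreeGroup.IsReduced.singleton (by simp)
  have hsub : ∀ x : F, x ∈ ({1} ∪ ⋃ t ∈ (univ : Set (ι × Bool)), (1 : F) • half b t : Set F) := by
    intro x
    by_cases hx : x = 1
    · exact Or.inl hx
    · obtain ⟨t, ht⟩ := exists_mem_half b hx
      exact Or.inr (mem_iUnion₂.2 ⟨t, mem_univ t, by rwa [one_smul]⟩)
  refine hroot.imp (fun h1 => ?_) fun h1 => ?_ <;>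
  exact ((finite_singleton (1 : F)).union h1).subset fun x hx =>
    (hsub x).imp id fun h' => ⟨h', hx⟩

end Whitehead

/-! ### Whitehead's algorithm -/

section CyclicWords

variable {F ι : Type*} [Group F] (b : FreeGroupBasis ι F)

/-- The word `L` spells a conjugate of `y`. -/
def Represents (y : F) (L : List (ι × Bool)) : Prop := ∃ c, y = c * eval b L * c⁻¹

/-- The length of a shortest word that spells a conjugate of `y`. -/
def cycLength (y : F) : ℕ := sInf {n | ∃ L, Represents b y L ∧ L.length = n}

/-- The word `L` is a shortest word that spells a conjugate of `y`. -/
def IsShortest (y : F) (L : List (ι × Bool)) : Prop :=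
  Represents b y L ∧ L.length = cycLength b y

theorem exists_isShortest (y : F) : ∃ L, IsShortest b y L :=
  Nat.sInf_mem (s := {n | ∃ L, Represents b y L ∧ L.length = n})
    ⟨_, word b y, ⟨1, by simp [eval_word]⟩, rfl⟩

variable {b}

theorem Represents.cycLength_le {y : F} {L : List (ι × Bool)} (h : Represents b y L) :
    cycLength b y ≤ L.length := Nat.sInf_le ⟨L, h, rfl⟩

theorem Represents.conj {y : F} {L L' : List (ι × Bool)} (h : Represents b y L) (d : F)
    (h' : eval b L = d * eval b L' * d⁻¹) : Represents b y L' := by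
  obtain ⟨c, rfl⟩ := h
  exact ⟨c * d, by rw [h']; group⟩

theorem Represents.inv {y : F} {L : List (ι × Bool)} (h : Represents b y L) :
    Represents b y⁻¹ (FreeGroup.invRev L) := by
  obtain ⟨c, rfl⟩ := h
  exact ⟨c, by rw [eval_invRev]; group⟩

theorem cycLength_inv_le (y : F) : cycLength b y⁻¹ ≤ cycLength b y := by
  obtain ⟨L, h, hL⟩ := exists_isShortest b y
  rw [← hL, ← FreeGroup.invRev_length (L₁ := L)]
  exact h.inv.cycLength_le

theorem IsShortest.inv {y : F} {L : List (ι × Bool)} (h : IsShortest b y L) :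
    IsShortest b y⁻¹ (FreeGroup.invRev L) := by
  refine ⟨h.1.inv, ?_⟩
  rw [FreeGroup.invRev_length, h.2]
  refine le_antisymm ?_ (cycLength_inv_le y)
  simpa using cycLength_inv_le (b := b) y⁻¹

theorem IsShortest.rotate {y : F} {L L' : List (ι × Bool)} (h : IsShortest b y (L ++ L')) :
    IsShortest b y (L' ++ L) := by
  refine ⟨h.1.conj (eval b L) ?_, ?_⟩
  · rw [eval_append, eval_append]; group
  · rw [← h.2, List.length_append, List.length_append, add_comm]

/-- Reducing the word, or stripping mutually inverse first and last letters, would give a shorter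
representative. -/
theorem IsShortest.isCyclicallyReduced {y : F} {L : List (ι × Bool)} (h : IsShortest b y L) :
    FreeGroup.IsCyclicallyReduced L := by
  classical
  refine ⟨?_, fun s hs t ht h1 => ?_⟩
  · have hred : FreeGroup.Red L (FreeGroup.reduce L) := FreeGroup.reduce.red
    have h1 : Represents b y (FreeGroup.reduce L) := h.1.conj 1 (by
      rw [eval, eval, FreeGroup.reduce.self]; simp)
    have h2 := h.2 ▸ h1.cycLength_le
    rw [← hred.sublist.eq_of_length_le h2]
    exact FreeGroup.isReduced_iff_reduce_eq.2 FreeGroup.reduce.idem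
  · by_contra h2
    have hst : s = bar t := by
      refine Prod.ext h1 ?_
      change s.2 = !t.2
      revert h2
      cases s.2 <;> cases t.2 <;> simp
    obtain ⟨M, rfl⟩ := List.head?_eq_some_iff.1 ht
    rcases List.eq_nil_or_concat M with rfl | ⟨M', u, rfl⟩
    · simp only [List.getLast?_singleton, Option.mem_def, Option.some.injEq] at hs
      exact h2 (by rw [hs])
    · rw [List.concat_eq_append, ← List.cons_append, List.getLast?_append] at hs
      simp only [List.getLast?_singleton, Option.some_or, Option.mem_def, Option.some.injEq] at hs
      have h3 : Represents b y M' := h.1.conj (letter b t) (by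
        rw [List.concat_eq_append, eval_cons, eval_append, hs, hst, eval_singleton, letter_bar,
          mul_assoc])
      have h4 := h.2 ▸ h3.cycLength_le
      simp at h4

theorem IsShortest.ne_nil {y : F} (hy : y ≠ 1) {L : List (ι × Bool)} (h : IsShortest b y L) :
    L ≠ [] := by
  rintro rfl
  obtain ⟨c, hc⟩ := h.1
  exact hy (by rw [hc, eval_nil]; simp)

variable (b) in
/-- The turns taken by the shortest cyclic words that represent the elements of `S`. -/
def Turn (S : Set F) (p q : ι × Bool) : Prop :=
  ∃ y ∈ S, ∃ L, IsShortest b y L ∧ L.head? = some q ∧ L.getLast? = some (bar p)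

theorem Turn.symm {S : Set F} (hS : ∀ y ∈ S, y⁻¹ ∈ S) {p q : ι × Bool} (h : Turn b S p q) :
    Turn b S q p := by
  obtain ⟨y, hy, L, hL, h1, h2⟩ := h
  refine ⟨_, hS y hy, _, hL.inv, ?_, ?_⟩
  · rw [head?_invRev, h2, Option.map_some, bar_bar]
  · have h3 := head?_invRev (FreeGroup.invRev L)
    rw [FreeGroup.invRev_invRev, h1] at h3
    obtain ⟨u, hu, hu'⟩ := Option.map_eq_some_iff.1 h3.symm
    rw [hu, ← hu', bar_bar]

theorem Turn.ne {S : Set F} {p q : ι × Bool} (h : Turn b S p q) : p ≠ q := by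
  rintro rfl
  obtain ⟨y, hy, L, hL, h1, h2⟩ := h
  have := hL.isCyclicallyReduced.2 _ h2 _ h1
  simp at this

/-- `Turn` looks only at the junction between the last and the first letter; a rotation brings any
interior turn there. -/
theorem IsShortest.turn_getElem {S : Set F} {y : F} (hy : y ∈ S) {L : List (ι × Bool)}
    (hL : IsShortest b y L) (i : ℕ) (hi : i + 1 < L.length) :
    Turn b S (bar L[i]) L[i + 1] := by
  have h : IsShortest b y (L.drop (i + 1) ++ L.take (i + 1)) := by
    refine IsShortest.rotate ?_
    rwa [List.take_append_drop]
  refine ⟨y, hy, _, h, ?_, ?_⟩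
  · rw [List.drop_eq_getElem_cons hi]
    simp
  · rw [bar_bar, ← List.take_append_getElem (by omega), ← List.append_assoc, List.getLast?_concat]

theorem IsShortest.isChain_turn {S : Set F} {y : F} (hy : y ∈ S) {L : List (ι × Bool)}
    (hL : IsShortest b y L) : L.IsChain fun x x' => Turn b S (bar x) x' := by
  rw [List.isChain_iff_getElem]
  exact fun i hi => hL.turn_getElem hy i hi

/-- Positive powers of `L` begin with `q`, negative powers with `p`. -/
theorem Turn.joined {S : Set F} (hS : ∀ y ∈ S, y ≠ 1) {p q : ι × Bool} (h : Turn b S p q) :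
    Joined b S p q := by
  have := isMulTorsionFree_of_basis b
  obtain ⟨y, hy, L, hL, h1, h2⟩ := h
  refine ⟨y, hy, hS y hy, Or.inr ?_⟩
  obtain ⟨c, hc⟩ := hL.1
  have hL1 : eval b L ≠ 1 := fun h => hS y hy (by rw [hc, h]; simp)
  rw [hc]
  refine Connects.conj hL1 (almostInvariant_half b q) (almostInvariant_half b p) ?_ c
  have hcyc := hL.isCyclicallyReduced
  refine ⟨1, Filter.eventually_atTop.2 ⟨1, fun n hn => ?_⟩,
    Filter.eventually_atTop.2 ⟨1, fun n hn => ?_⟩⟩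
  · rw [one_mul]
    exact eval_pow_mem_half hcyc h1 (by omega)
  · rw [one_mul, ← bar_bar p]
    exact eval_inv_pow_mem_half hcyc h2 (by omega)

end CyclicWords

/-! ### Whitehead automorphisms and cyclic length -/

section WhiteheadAutomorphism

variable {F ι : Type*} [Group F] (b : FreeGroupBasis ι F)

open Classical in
/-- `letter b z` or `1`. -/
def shiftBy (z : ι × Bool) (p : Prop) : F := if p then letter b z else 1

theorem shiftBy_true {z : ι × Bool} {p : Prop} (h : p) : shiftBy b z p = letter b z := if_pos h

theorem shiftBy_false {z : ι × Bool} {p : Prop} (h : ¬p) : shiftBy b z p = 1 := if_neg h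

/-- The Whitehead automorphism that slides the half-edges in `P` over the edge `z`, as a change of
basis. -/
theorem exists_whitehead_basis {P : Set (ι × Bool)} {z : ι × Bool} (hz : z ∉ P)
    (hz' : bar z ∉ P) :
    ∃ b' : FreeGroupBasis ι F, ∀ x, letter b' x =
      (shiftBy b z (x ∈ P))⁻¹ * letter b x * shiftBy b z (bar x ∈ P) := by
  have hlift : ∀ f : F →* F, ∀ e : Prop → F,
      (∀ i, f (b i) = (e ((i, true) ∈ P))⁻¹ * b i * e ((i, false) ∈ P)) →
      ∀ x, f (letter b x) = (e (x ∈ P))⁻¹ * letter b x * e (bar x ∈ P) := by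
    rintro f e hf ⟨i, _ | _⟩
    · have : letter b (i, false) = (b i)⁻¹ := letter_bar b (i, true)
      rw [this, map_inv, hf]
      change _ = (e ((i, false) ∈ P))⁻¹ * (b i)⁻¹ * e ((i, true) ∈ P)
      group
    · exact hf i
  let φ : F →* F := b.lift fun i =>
    (shiftBy b z ((i, true) ∈ P))⁻¹ * b i * shiftBy b z ((i, false) ∈ P)
  let ψ : F →* F := b.lift fun i =>
    ((shiftBy b z ((i, true) ∈ P))⁻¹)⁻¹ * b i * (shiftBy b z ((i, false) ∈ P))⁻¹
  have hφ := hlift φ (shiftBy b z) fun i => by simp [φ]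
  have hψ := hlift ψ (fun p => (shiftBy b z p)⁻¹) fun i => by simp [ψ]
  have hφz : ∀ p, φ (shiftBy b z p) = shiftBy b z p := by
    intro p
    by_cases hp : p
    · rw [shiftBy_true b hp, hφ, shiftBy_false b hz, shiftBy_false b hz']
      simp
    · rw [shiftBy_false b hp, map_one]
  have hψz : ∀ p, ψ (shiftBy b z p) = shiftBy b z p := by
    intro p
    by_cases hp : p
    · rw [shiftBy_true b hp, hψ, shiftBy_false b hz, shiftBy_false b hz']
      simp
    · rw [shiftBy_false b hp, map_one]
  -- Both maps fix `z`, as neither `z` nor `bar z` lies in `P`; hence the shifts by `z` and by its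
  -- inverse cancel.
  let e : F ≃* F := MonoidHom.toMulEquiv φ ψ
    (b.ext_hom _ _ fun i => by
      rw [← letter_true]
      simp [hφ, hψ, hψz, mul_assoc])
    (b.ext_hom _ _ fun i => by
      rw [← letter_true]
      simp [hφ, hψ, hφz, mul_assoc])
  refine ⟨b.map e, fun x => ?_⟩
  rw [← hφ]
  rfl

variable {b} {b' : FreeGroupBasis ι F} {P : Set (ι × Bool)} {z : ι × Bool}

/-- The turn from `x` to `y` involves only `P` and `z`, or no half-edge in `P`. -/
def GoodTurn (P : Set (ι × Bool)) (z x y : ι × Bool) : Prop :=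
  (bar x ∈ P → y ∈ P ∨ y = z) ∧ (y ∈ P → bar x ∈ P ∨ bar x = z)

/-- A shift is attached to each turn, equal to `z` if the turn touches `P`. For `q` different from
`z` and `bar z`, good turns make the two shifts agree with those in `hb`, and the block is one
letter of `b'`. For `q = z` or `bar z` the letter survives or cancels against a shift; the
cancellation saves length. -/
theorem exists_block (hz : z ∉ P) (hz' : bar z ∉ P) (hb : ∀ x, letter b' x =
      (shiftBy b z (x ∈ P))⁻¹ * letter b x * shiftBy b z (bar x ∈ P)) {p q r : ι × Bool}
    (h1 : GoodTurn P z p q) (h2 : GoodTurn P z q r) :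
    ∃ W : List (ι × Bool), W.length ≤ 1 ∧ (q = z → bar p ∈ P → W = []) ∧
      eval b' W = (shiftBy b z (bar p ∈ P ∨ q ∈ P))⁻¹ * letter b q *
        shiftBy b z (bar q ∈ P ∨ r ∈ P) := by
  have hbz : letter b' z = letter b z := by
    rw [hb, shiftBy_false b hz, shiftBy_false b hz']; simp
  by_cases hq : q = z
  · subst hq
    have hr : ¬(bar q ∈ P ∨ r ∈ P) := by
      rintro (h | h)
      · exact hz' h
      · exact (h2.2 h).elim hz' (bar_ne q)
    rw [shiftBy_false b hr]
    by_cases hp : bar p ∈ P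
    · exact ⟨[], by simp, fun _ _ => rfl, by rw [shiftBy_true b (Or.inl hp), eval_nil]; simp⟩
    · refine ⟨[q], by simp, fun _ h => (hp h).elim, ?_⟩
      rw [shiftBy_false b (by tauto), eval_singleton, hbz]
      simp
  by_cases hq' : q = bar z
  · subst hq'
    have hp : ¬(bar p ∈ P ∨ bar z ∈ P) := by
      rintro (h | h)
      · exact (h1.1 h).elim hz' hq
      · exact hz' h
    rw [shiftBy_false b hp]
    by_cases hr : r ∈ P
    · refine ⟨[], by simp, fun _ _ => rfl, ?_⟩
      rw [shiftBy_true b (Or.inr hr), eval_nil, letter_bar]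
      simp
    · refine ⟨[bar z], by simp, fun h => (hq h).elim, ?_⟩
      rw [shiftBy_false b (by rw [bar_bar]; tauto), eval_singleton, letter_bar, letter_bar, hbz]
      simp
  · refine ⟨[q], by simp, fun h => (hq h).elim, ?_⟩
    have e1 : (bar p ∈ P ∨ q ∈ P) = (q ∈ P) := propext
      ⟨fun h => h.elim (fun h => (h1.1 h).resolve_right hq) id, Or.inr⟩
    have e2 : (bar q ∈ P ∨ r ∈ P) = (bar q ∈ P) := propext
      ⟨fun h => h.elim id fun h => (h2.2 h).resolve_right fun h' => hq' (by rw [← h', bar_bar]),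
        Or.inl⟩
    rw [e1, e2, eval_singleton, hb]

/-- The blocks are concatenated and the shifts between them telescope. The letters `p` and `r` are
the neighbours of `M`; as default values they make the two outer shifts agree when `M` is empty. -/
theorem exists_rewrite (hz : z ∉ P) (hz' : bar z ∉ P) (hb : ∀ x, letter b' x =
      (shiftBy b z (x ∈ P))⁻¹ * letter b x * shiftBy b z (bar x ∈ P)) (M : List (ι × Bool))
    (p r : ι × Bool) (hM : (p :: (M ++ [r])).IsChain (GoodTurn P z)) :
    ∃ W : List (ι × Bool), W.length ≤ M.length ∧
      (M.head? = some z → bar p ∈ P → W.length < M.length) ∧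
      eval b' W = (shiftBy b z (bar p ∈ P ∨ M.headD r ∈ P))⁻¹ * eval b M *
        shiftBy b z (bar (M.getLastD p) ∈ P ∨ r ∈ P) := by
  induction M generalizing p with
  | nil => exact ⟨[], by simp, by simp, by simp [eval_nil]⟩
  | cons q M ih =>
    rw [List.cons_append, List.isChain_cons_cons] at hM
    obtain ⟨W', h1, -, h2⟩ := ih q hM.2
    have hnext : GoodTurn P z q (M.headD r) := by
      cases M with
      | nil => exact (List.isChain_cons_cons.1 hM.2).1
      | cons s M => exact (List.isChain_cons_cons.1 hM.2).1
    obtain ⟨W, h3, h4, h5⟩ := exists_block hz hz' hb hM.1 hnext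
    refine ⟨W ++ W', ?_, fun hq hp => ?_, ?_⟩
    · simp only [List.length_append, List.length_cons]
      omega
    · rw [h4 (by simpa using hq) hp, List.nil_append, List.length_cons]
      omega
    · rw [eval_append, h5, h2, eval_cons, List.headD_cons, List.getLastD_cons]
      group

/-- Read cyclically, `L` is preceded by its last letter `bar p` and followed by its first letter
`q`. The outer shifts then coincide, so the rewritten word represents a conjugate. -/
theorem IsShortest.exists_rewrite {S : Set F} (hz : z ∉ P) (hz' : bar z ∉ P)
    (hb : ∀ x, letter b' x =
      (shiftBy b z (x ∈ P))⁻¹ * letter b x * shiftBy b z (bar x ∈ P))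
    (hS : ∀ p q, Turn b S p q → (p ∈ P → q ∈ P ∨ q = z) ∧ (q ∈ P → p ∈ P ∨ p = z))
    {y : F} (hy : y ∈ S) {L : List (ι × Bool)} (hL : IsShortest b y L) {p q : ι × Bool}
    (hq : L.head? = some q) (hp : L.getLast? = some (bar p)) :
    cycLength b' y ≤ cycLength b y ∧ (q = z → p ∈ P → cycLength b' y < cycLength b y) := by
  have hturn : Turn b S p q := ⟨y, hy, L, hL, hq, hp⟩
  have hgood : ∀ x x', Turn b S (bar x) x' → GoodTurn P z x x' := fun x x' h => hS _ _ h
  have hpq : GoodTurn P z (bar p) q := hgood _ _ (by rwa [bar_bar])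
  have hchain : (bar p :: (L ++ [q])).IsChain (GoodTurn P z) := by
    rw [← List.cons_append, List.isChain_append, List.isChain_cons]
    refine ⟨⟨fun x hx => ?_, (hL.isChain_turn hy).imp hgood⟩, List.isChain_singleton _, ?_⟩
    · rw [hq] at hx
      obtain rfl := Option.some.inj hx
      exact hpq
    · intro x hx x' hx'
      obtain rfl : q = x' := by simpa using hx'
      rw [List.getLast?_cons, hp] at hx
      obtain rfl : bar p = x := by simpa using hx
      exact hpq
  obtain ⟨W, h1, h2, h3⟩ := RelCurrents.exists_rewrite hz hz' hb L _ _ hchain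
  have e1 : L.headD q = q := by rw [List.headD_eq_head?_getD, hq]; rfl
  have e2 : L.getLastD (bar p) = bar p := by rw [List.getLastD_eq_getLast?, hp]; rfl
  rw [e1, e2] at h3
  have hrep : Represents b' y W := by
    obtain ⟨c, hc⟩ := hL.1
    exact ⟨c * shiftBy b z (bar (bar p) ∈ P ∨ q ∈ P), by rw [h3, hc]; group⟩
  rw [← hL.2]
  exact ⟨hrep.cycLength_le.trans h1, fun hqz hpP =>
    hrep.cycLength_le.trans_lt (h2 (by rw [hq, hqz]) (by rwa [bar_bar]))⟩

end WhiteheadAutomorphism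

/-! ### Bases of minimal total length -/

section Minimal

variable {F ι : Type*} [Group F] {b : FreeGroupBasis ι F} {S : Finset F}

variable (b S) in
/-- The total cyclic length of the elements of `S` is minimal for the basis `b`. -/
def IsOptimal : Prop :=
  ∀ b' : FreeGroupBasis ι F, ∑ y ∈ S, cycLength b y ≤ ∑ y ∈ S, cycLength b' y

theorem exists_isOptimal (b₀ : FreeGroupBasis ι F) (S : Finset F) :
    ∃ b : FreeGroupBasis ι F, IsOptimal b S := by
  obtain ⟨b, -, hb⟩ := (measure fun b : FreeGroupBasis ι F => ∑ y ∈ S, cycLength b y).wf.has_min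
    univ ⟨b₀, mem_univ _⟩
  exact ⟨b, fun b' => not_lt.1 (hb b' (mem_univ _))⟩

/-- If all turns leaving `P` go to `z`, sliding `P` over `z` lengthens no cyclic word and shortens
every one that takes such a turn. -/
theorem IsOptimal.not_turn (hopt : IsOptimal b S) (hS1 : ∀ y ∈ S, y ≠ 1)
    (hSinv : ∀ y ∈ S, y⁻¹ ∈ S) {P : Set (ι × Bool)} {z : ι × Bool} (hz : z ∉ P) (hz' : bar z ∉ P)
    (hP : ∀ p ∈ P, ∀ q ∉ P, Turn b S p q → q = z) : ∀ p ∈ P, ∀ q ∉ P, ¬ Turn b S p q := by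
  intro p hp q hq ht
  obtain rfl := hP p hp q hq ht
  obtain ⟨b', hb'⟩ := exists_whitehead_basis b hz hz'
  have hturn : ∀ p' q', Turn b (S : Set F) p' q' →
      (p' ∈ P → q' ∈ P ∨ q' = q) ∧ (q' ∈ P → p' ∈ P ∨ p' = q) := by
    refine fun p' q' h => ⟨fun h1 => ?_, fun h1 => ?_⟩
    · by_contra! h2
      exact h2.2 (hP p' h1 q' h2.1 h)
    · by_contra! h2
      exact h2.2 (hP q' h1 p' h2.1 (h.symm hSinv))
  refine (hopt b').not_gt ?_
  obtain ⟨y, hy, L, hL, h1, h2⟩ := ht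
  refine Finset.sum_lt_sum (fun y' hy' => ?_) ⟨y, hy, ?_⟩
  · obtain ⟨L', hL'⟩ := exists_isShortest b y'
    have hne := hL'.ne_nil (hS1 y' hy')
    exact (hL'.exists_rewrite hz hz' hb' hturn (S := S) hy'
      (p := bar (L'.getLast hne)) (List.head?_eq_some_head hne)
      (by rw [bar_bar]; exact List.getLast?_eq_some_getLast hne)).1
  · exact (hL.exists_rewrite hz hz' hb' hturn (S := S) hy h1 h2).2 rfl hp

theorem mem_closure_of_forall_mem {I : Set ι} {L : List (ι × Bool)} (h : ∀ x ∈ L, x.1 ∈ I) :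
    eval b L ∈ Subgroup.closure (b '' I) := by
  induction L with
  | nil => rw [eval_nil]; exact one_mem _
  | cons s L ih =>
    rw [eval_cons]
    refine mul_mem ?_ (ih fun x hx => h x (List.mem_cons_of_mem _ hx))
    have hs := h s List.mem_cons_self
    obtain ⟨i, _ | _⟩ := s
    · have : letter b (i, false) = (b i)⁻¹ := letter_bar b (i, true)
      rw [this]
      exact inv_mem (Subgroup.subset_closure ⟨i, hs, rfl⟩)
    · exact Subgroup.subset_closure ⟨i, hs, rfl⟩

/-- Consecutive letters of a shortest word lie on the same side of the partition, hence so do all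
its letters. -/
theorem exists_conj_mem_closure {I : Set ι} (hSinv : ∀ y ∈ S, y⁻¹ ∈ S)
    (hI : ∀ p q : ι × Bool, p.1 ∈ I → q.1 ∉ I → ¬ Turn b S p q) {y : F} (hy : y ∈ S) :
    ∃ c, c * y * c⁻¹ ∈ Subgroup.closure (b '' I) ∨ c * y * c⁻¹ ∈ Subgroup.closure (b '' Iᶜ) := by
  obtain ⟨L, hL⟩ := exists_isShortest b y
  obtain ⟨c, hc⟩ := hL.1
  refine ⟨c⁻¹, ?_⟩
  have e : c⁻¹ * y * c⁻¹⁻¹ = eval b L := by rw [hc]; group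
  rw [e]
  have hchain : L.IsChain fun x x' => (x.1 ∈ I ↔ x'.1 ∈ I) := by
    refine (hL.isChain_turn (S := S) hy).imp fun x x' h => ?_
    by_contra hne
    rcases not_iff.1 hne with hne
    by_cases hx : x.1 ∈ I
    · exact hI (bar x) x' hx (fun h' => hne.2 h' hx) h
    · exact hI x' (bar x) (hne.1 hx) hx (h.symm hSinv)
  cases L with
  | nil => left; rw [eval_nil]; exact one_mem _
  | cons s L =>
    have hall : ∀ x ∈ s :: L, (s.1 ∈ I ↔ x.1 ∈ I) := by
      clear hL hc e
      induction L generalizing s with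
      | nil => simp
      | cons t L ih =>
        rw [List.isChain_cons_cons] at hchain
        intro x hx
        rcases List.mem_cons.1 hx with rfl | hx
        · rfl
        · rw [hchain.1]
          exact ih t hchain.2 x hx
    by_cases hs : s.1 ∈ I
    · exact Or.inl (mem_closure_of_forall_mem fun x hx => (hall x hx).1 hs)
    · exact Or.inr (mem_closure_of_forall_mem fun x hx h => hs ((hall x hx).2 h))

/-- Whitehead's theorem: in an optimal basis, either the Whitehead graph is connected without cut
vertex, or a partition of the basis separates the given elements. -/
theorem IsOptimal.noCutVertex_or [Finite ι] (hopt : IsOptimal b S) (hS : S.Nonempty)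
    (hS1 : ∀ y ∈ S, y ≠ 1) (hSinv : ∀ y ∈ S, y⁻¹ ∈ S) :
    NoCutVertex (Joined b (S : Set F)) ∨ ∃ I : Set ι, I.Nonempty ∧ Iᶜ.Nonempty ∧ ∀ y ∈ S, ∃ c,
      c * y * c⁻¹ ∈ Subgroup.closure (b '' I) ∨ c * y * c⁻¹ ∈ Subgroup.closure (b '' Iᶜ) := by
  by_cases hT : NoCutVertex (Turn b (S : Set F))
  · exact Or.inl (hT.mono fun p q _ h => h.joined hS1)
  right
  suffices h : ∃ I : Set ι, I.Nonempty ∧ Iᶜ.Nonempty ∧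
      ∀ p q : ι × Bool, p.1 ∈ I → q.1 ∉ I → ¬ Turn b S p q by
    obtain ⟨I, h1, h2, h3⟩ := h
    exact ⟨I, h1, h2, fun y hy => exists_conj_mem_closure hSinv h3 hy⟩
  let invariantSets : Set (Set (ι × Bool)) :=
    {P | P.Nonempty ∧ Pᶜ.Nonempty ∧ ∀ p ∈ P, ∀ q ∉ P, ¬ Turn b S p q}
  have hne : invariantSets.Nonempty := by
    simp only [NoCutVertex, not_forall, not_exists, not_and] at hT
    obtain ⟨S₀, hS₀, P, hPS, hP1, ⟨q₀, hq₀⟩, hno⟩ := hT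
    rcases hS₀ with rfl | ⟨z, rfl⟩
    · exact ⟨P, hP1, ⟨q₀, hq₀.2⟩, fun p hp q hq => hno p hp q ⟨mem_univ q, hq⟩⟩
    -- Of the two sides of the cut vertex `z`, the one without `bar z` is slid over `z`; by
    -- optimality it is then isolated even from `z`.
    · by_cases hz : bar z ∈ P
      · refine ⟨{z}ᶜ \ P, ⟨q₀, hq₀⟩, ⟨z, by simp⟩, hopt.not_turn hS1 hSinv (z := z) (by simp)
          (fun h => h.2 hz) ?_⟩
        rintro p hp q hq ht
        by_contra hqz
        have hqP : q ∈ P := by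
          by_contra hqP
          exact hq ⟨hqz, hqP⟩
        exact hno q hqP p hp (ht.symm hSinv)
      · refine ⟨P, hP1, ⟨q₀, hq₀.2⟩, hopt.not_turn hS1 hSinv (z := z) (fun h => hPS h rfl) hz ?_⟩
        rintro p hp q hq ht
        by_contra hqz
        exact hno p hp q ⟨hqz, hq⟩ ht
  obtain ⟨P, ⟨⟨p₀, hp₀⟩, ⟨q₀, hq₀⟩, hno⟩, hmin⟩ :=
    (measure (Set.ncard : Set (ι × Bool) → ℕ)).wf.has_min invariantSets hne
  by_cases hclosed : ∀ x ∈ P, bar x ∈ P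
  · have hmem : ∀ x y : ι × Bool, x.1 = y.1 → x ∈ P → y ∈ P := by
      rintro ⟨i, e⟩ ⟨j, f⟩ rfl hx
      by_cases hef : e = f
      · exact hef ▸ hx
      · have := hclosed _ hx
        convert this
        revert hef
        cases e <;> cases f <;> simp
    refine ⟨Prod.fst '' P, ⟨_, p₀, hp₀, rfl⟩, ⟨q₀.1, ?_⟩, ?_⟩
    · rintro ⟨x, hx, he⟩
      exact hq₀ (hmem x q₀ he hx)
    · rintro p q ⟨x, hx, he⟩ hq
      exact hno p (hmem x p he hx) q fun h => hq ⟨q, h, rfl⟩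
  · push Not at hclosed
    obtain ⟨z, hz, hz'⟩ := hclosed
    by_cases hP : (P \ {z}).Nonempty
    -- All turns leaving `P \ {z}` go to `z`, so by optimality there are none, against the
    -- minimality of `P`.
    · have hlt : (P \ {z}).ncard < P.ncard := Set.ncard_sdiff_singleton_lt_of_mem hz (toFinite P)
      refine (hmin (P \ {z}) ⟨hP, ⟨z, by simp⟩, ?_⟩ hlt).elim
      refine hopt.not_turn hS1 hSinv (z := z) (by simp) (fun h => hz' h.1) ?_
      rintro p hp q hq ht
      by_contra hqz
      exact hno p hp.1 q (fun h => hq ⟨h, hqz⟩) ht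
    · have hPz : ∀ x ∈ P, x = z := by
        intro x hx
        by_contra h
        exact hP ⟨x, hx, h⟩
      have hz1 : ∀ q, ¬ Turn b S z q := by
        intro q h
        by_cases hq : q ∈ P
        · exact h.ne (hPz q hq).symm
        · exact hno z hz q hq h
      -- A turn at `bar z` comes from a word ending in `z`; its rotation begins with `z` and takes a
      -- turn at `z`. So shortest words do not involve this basis element at all.
      have hz2 : ∀ q, ¬ Turn b S (bar z) q := by
        rintro q ⟨y, hy, L, hL, h1, h2⟩
        rw [bar_bar] at h2
        obtain ⟨M, rfl⟩ := List.getLast?_eq_some_iff.1 h2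
        have hL' := hL.rotate
        rw [List.singleton_append] at hL'
        have hne : z :: M ≠ [] := List.cons_ne_nil _ _
        refine hz1 _ (Turn.symm hSinv (p := bar ((z :: M).getLast hne)) ⟨y, hy, _, hL', rfl, ?_⟩)
        rw [bar_bar]
        exact List.getLast?_eq_some_getLast hne
      have hz3 : ∀ p q : ι × Bool, p.1 = z.1 → ¬ Turn b S p q := by
        intro p q hp
        by_cases h : p = z
        · exact h ▸ hz1 q
        · have : p = bar z := by
            refine Prod.ext hp ?_
            change p.2 = !z.2
            have : p.2 ≠ z.2 := fun h' => h (Prod.ext hp h')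
            revert this
            cases p.2 <;> cases z.2 <;> simp
          exact this ▸ hz2 q
      refine ⟨{z.1}, ⟨z.1, rfl⟩, ?_, fun p q hp _ => hz3 p q hp⟩
      obtain ⟨y, hy⟩ := hS
      obtain ⟨L, hL⟩ := exists_isShortest b y
      have hne := hL.ne_nil (hS1 y hy)
      refine ⟨(L.getLast hne).1, fun h => hz3 (bar (L.getLast hne)) (L.head hne) h
        ⟨y, hy, L, hL, List.head?_eq_some_head hne, ?_⟩⟩
      rw [bar_bar]
      exact List.getLast?_eq_some_getLast hne

end Minimal

/-! ### Free splittings given by partitions of a basis -/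

section Splitting

variable {F ι : Type*} [Group F] {b : FreeGroupBasis ι F}

theorem forall_mem_word_of_mem_closure {I : Set ι} {x : F} (hx : x ∈ Subgroup.closure (b '' I)) :
    ∀ s ∈ word b x, s.1 ∈ I := by
  classical
  induction hx using Subgroup.closure_induction with
  | mem x hx =>
    obtain ⟨i, hi, rfl⟩ := hx
    rw [← letter_true, ← eval_singleton, word_eval FreeGroup.IsReduced.singleton]
    simpa using hi
  | one => simp [word_one]
  | mul x y _ _ hx hy =>
    intro s hs
    have h : List.Sublist (word b (x * y)) (word b x ++ word b y) := by
      simp only [word, map_mul]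
      exact FreeGroup.toWord_mul_sublist _ _
    exact (List.mem_append.1 (h.subset hs)).elim (hx s) (hy s)
  | inv x _ hx =>
    intro s hs
    rw [word_inv] at hs
    simp only [FreeGroup.invRev, List.mem_reverse, List.mem_map] at hs
    obtain ⟨t, ht, rfl⟩ := hs
    exact hx t ht

variable (b) in
theorem basis_ne_one (i : ι) : b i ≠ 1 := by
  intro h
  have := word_one b
  rw [← h, ← letter_true, ← eval_singleton, word_eval FreeGroup.IsReduced.singleton] at this
  simp at this

variable (b) in
theorem basis_mem_closure_iff {I : Set ι} {i : ι} :
    b i ∈ Subgroup.closure (b '' I) ↔ i ∈ I := by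
  refine ⟨fun h => ?_, fun h => Subgroup.subset_closure ⟨i, h, rfl⟩⟩
  have := forall_mem_word_of_mem_closure h (i, true)
  rw [← letter_true, ← eval_singleton, word_eval FreeGroup.IsReduced.singleton] at this
  exact this (by simp)

variable (b) in
/-- The free factor system given by a partition of a basis. -/
def FreeFactorSystem.ofColoring {k : ℕ} (κ : ι → Fin k) (hκ : Function.Surjective κ) :
    FreeFactorSystem F where
  k := k
  factor j := Subgroup.closure (b '' (κ ⁻¹' {j}))
  N := 0
  cofactor := 1
  factor_ne_bot j := by
    obtain ⟨i, rfl⟩ := hκ j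
    exact fun h => basis_ne_one b i ((Subgroup.mem_bot).1 (h ▸ Subgroup.subset_closure ⟨i, rfl, rfl⟩))
  bijective := by
    let G : Fin k → Subgroup F := fun j => Subgroup.closure (b '' (κ ⁻¹' {j}))
    let f : Monoid.Coprod (Monoid.CoprodI fun j => G j) (FreeGroup (Fin 0)) →* F :=
      Monoid.Coprod.lift (Monoid.CoprodI.lift fun j => (G j).subtype) 1
    let θ : F →* Monoid.Coprod (Monoid.CoprodI fun j => G j) (FreeGroup (Fin 0)) := b.lift fun i =>
      Monoid.Coprod.inl (Monoid.CoprodI.of (i := κ i)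
        (⟨b i, Subgroup.subset_closure ⟨i, rfl, rfl⟩⟩ : G (κ i)))
    have hθ : ∀ j x (hx : x ∈ G j), θ x = Monoid.Coprod.inl (Monoid.CoprodI.of (i := j)
        (⟨x, hx⟩ : G j)) := by
      intro j x hx
      induction hx using Subgroup.closure_induction with
      | mem x hx =>
        obtain ⟨i, rfl, rfl⟩ := hx
        simp [θ]
      | one =>
        rw [map_one, show (⟨1, one_mem _⟩ : G j) = 1 from rfl, map_one, map_one]
      | mul x y hx hy ihx ihy =>
        rw [map_mul, ihx, ihy, ← map_mul, ← map_mul]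
        rfl
      | inv x hx ihx =>
        rw [map_inv, ihx, ← map_inv, ← map_inv]
        rfl
    have h1 : f.comp θ = MonoidHom.id F := b.ext_hom _ _ fun i => by simp [f, θ]
    have h2 : θ.comp f = MonoidHom.id _ := by
      refine Monoid.Coprod.hom_ext (Monoid.CoprodI.ext_hom _ _ fun j => MonoidHom.ext fun x => ?_)
        (FreeGroup.ext_hom _ _ fun i => i.elim0)
      have := hθ j x x.2
      simpa [f] using this
    exact ⟨Function.LeftInverse.injective (g := θ) fun x => DFunLike.congr_fun h2 x,
      Function.RightInverse.surjective (g := θ) fun x => DFunLike.congr_fun h1 x⟩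

theorem FreeFactorSystem.ofColoring_isNontrivial {κ : ι → Fin 2} (hκ : Function.Surjective κ) :
    (FreeFactorSystem.ofColoring b κ hκ).IsNontrivial := by
  have key : ∀ j : Fin 2, Subgroup.closure (b '' (κ ⁻¹' {j})) ≠ ⊤ := by
    intro j h
    obtain ⟨i, hi⟩ := hκ (j + 1)
    have : b i ∈ Subgroup.closure (b '' (κ ⁻¹' {j})) := h ▸ Subgroup.mem_top _
    rw [basis_mem_closure_iff, mem_preimage, mem_singleton_iff, hi] at this
    exact (by decide : ∀ j : Fin 2, j + 1 ≠ j) j this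
  exact ⟨two_ne_zero, key⟩

variable (b) in
/-- The element `y` is conjugate into the free factor spanned by `I` or into the complementary
free factor. -/
def Elliptic (I : Set ι) (y : F) : Prop :=
  ∃ c, c * y * c⁻¹ ∈ Subgroup.closure (b '' I) ∨ c * y * c⁻¹ ∈ Subgroup.closure (b '' Iᶜ)

theorem elliptic_compl {I : Set ι} {y : F} : Elliptic b Iᶜ y ↔ Elliptic b I y := by
  simp only [Elliptic, compl_compl, or_comm]

theorem elliptic_one (I : Set ι) : Elliptic b I 1 := ⟨1, Or.inl (by simp)⟩

theorem Elliptic.conj {I : Set ι} {y : F} (h : Elliptic b I y) (d : F) :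
    Elliptic b I (d * y * d⁻¹) := by
  obtain ⟨c, hc⟩ := h
  refine ⟨c * d⁻¹, ?_⟩
  have : c * d⁻¹ * (d * y * d⁻¹) * (c * d⁻¹)⁻¹ = c * y * c⁻¹ := by group
  rwa [this]

/-- A reduced word that begins with a letter in `I` and ends with a letter outside of `I` does not
represent an elliptic element. -/
theorem not_elliptic_eval {I : Set ι} {L : List (ι × Bool)} (hL : FreeGroup.IsReduced L)
    {s t : ι × Bool} (hs : L.head? = some s) (ht : L.getLast? = some t) (hsI : s.1 ∈ I)
    (htI : t.1 ∉ I) : ¬ Elliptic b I (eval b L) := by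
  have := isMulTorsionFree_of_basis b
  rintro ⟨c, hc⟩
  have hcyc : FreeGroup.IsCyclicallyReduced L := by
    refine ⟨hL, fun u hu v hv h => ?_⟩
    obtain rfl : t = u := Option.some.inj (ht.symm.trans hu)
    obtain rfl : s = v := Option.some.inj (hs.symm.trans hv)
    exact (htI (h ▸ hsI)).elim
  -- One side of an edge of the splitting: `X ∪ {1}` is right invariant under the factor of `I` and
  -- `X` under that of `Iᶜ`, while the axis of `eval b L` crosses `X`.
  let X : Set F := {x | ∃ u, x ∈ half b u ∧ u.1 ∈ I}
  have hX : ∀ (x : F) (i : ι), x ≠ 1 → x * b i ≠ 1 → (x * b i ∈ X ↔ x ∈ X) := by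
    intro x i h1 h2
    simp only [X, mem_ofPred_eq, mem_half]
    rw [← letter_true, head_word_mul_letter b h1 h2]
  have hXai : AlmostInvariant X := by
    refine almostInvariant_of_closure _ (closure_range_basis b) ?_
    rintro _ ⟨i, rfl⟩
    refine (Set.toFinite {1, (b i)⁻¹}).subset fun x hx => ?_
    by_contra h
    simp only [mem_insert_iff, mem_singleton_iff, not_or, eq_inv_iff_mul_eq_one] at h
    exact hx (hX x i h.1 h.2).symm
  have hX1 : (1 : F) ∉ X := fun ⟨u, hu, _⟩ => one_notMem_half b u hu
  have hletter : ∀ (u : ι × Bool) x, x ∈ half b u → (x ∈ X ↔ u.1 ∈ I) := fun u x hx =>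
    ⟨fun ⟨v, hv, hvI⟩ => half_disjoint b hx hv ▸ hvI, fun h => ⟨u, hx, h⟩⟩
  have hinv : ∀ (X' : Set F) (J : Set ι), (∀ i ∈ J, ∀ x, x * b i ∈ X' ↔ x ∈ X') →
      ∀ k ∈ Subgroup.closure (b '' J), ∀ x, x * k ∈ X' ↔ x ∈ X' := by
    intro X' J h k hk
    induction hk using Subgroup.closure_induction with
    | mem k hk =>
      obtain ⟨i, hi, rfl⟩ := hk
      exact h i hi
    | one => simp
    | mul k l _ _ hk hl => intro x; rw [← mul_assoc, hl, hk]
    | inv k _ hk => intro x; rw [← hk (x * k⁻¹), inv_mul_cancel_right]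
  have hbI : ∀ i, b i ∈ X ↔ i ∈ I := fun i => hletter (i, true) _ (letter_mem_half b (i, true))
  have hbI' : ∀ i, (b i)⁻¹ ∈ X ↔ i ∈ I := fun i => hletter (i, false) _ (by
    have : letter b (i, false) = (b i)⁻¹ := letter_bar b (i, true)
    rw [← this]
    exact letter_mem_half b (i, false))
  have hI : ∀ k ∈ Subgroup.closure (b '' I), ∀ x, x ∈ insert 1 X → x * k ∈ insert 1 X := by
    refine fun k hk x => (hinv (insert 1 X) I (fun i hi x => ?_) k hk x).2
    simp only [mem_insert_iff]
    by_cases h1 : x = 1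
    · simp [h1, (hbI i).2 hi]
    by_cases h2 : x * b i = 1
    · rw [eq_inv_iff_mul_eq_one.symm] at h2
      simp [h2, (hbI' i).2 hi]
    · simp [h1, h2, hX x i h1 h2]
  have hIc : ∀ k ∈ Subgroup.closure (b '' Iᶜ), ∀ x, x ∈ X → x * k ∈ X := by
    refine fun k hk x => (hinv X Iᶜ (fun i hi x => ?_) k hk x).2
    by_cases h1 : x = 1
    · rw [h1, one_mul]
      exact iff_of_false (fun h => hi ((hbI i).1 h)) hX1
    by_cases h2 : x * b i = 1
    · rw [h2]
      rw [eq_inv_iff_mul_eq_one.symm] at h2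
      rw [h2]
      exact iff_of_false hX1 fun h => hi ((hbI' i).1 h)
    · exact hX x i h1 h2
  have hne : eval b L ≠ 1 := by
    intro h
    have := word_eval (b := b) hL
    rw [h, word_one] at this
    rw [← this] at hs
    simp at hs
  have hconn : Connects (eval b L) X Xᶜ := by
    refine ⟨1, Filter.eventually_atTop.2 ⟨1, fun n hn => ?_⟩,
      Filter.eventually_atTop.2 ⟨1, fun n hn => ?_⟩⟩
    · rw [one_mul, hletter s _ (eval_pow_mem_half hcyc hs (by omega))]
      exact hsI
    · rw [one_mul, mem_compl_iff, hletter (bar t) _ (eval_inv_pow_mem_half hcyc ht (by omega))]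
      exact htI
  rcases hc with hc | hc
  · refine not_connects_of_invariant (X' := insert 1 X) hXai ?_ ?_ hI hne hc hconn
    · rw [sdiff_eq_empty.2 (subset_insert _ _)]; exact finite_empty
    · refine (finite_singleton 1).subset fun x hx => hx.1.resolve_right hx.2
  · exact not_connects_of_invariant (X' := X) hXai (by simp) (by simp) hIc hne hc hconn

theorem isReduced_append_of_ne {L M : List (ι × Bool)} (hL : FreeGroup.IsReduced L)
    (hM : FreeGroup.IsReduced M)
    (h : ∀ s, L.getLast? = some s → ∀ t, M.head? = some t → s.1 ≠ t.1) :
    FreeGroup.IsReduced (L ++ M) := by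
  rw [FreeGroup.IsReduced, List.isChain_append]
  exact ⟨hL, hM, fun s hs t ht he => (h s hs t ht he).elim⟩

/-- Elliptic `y` and `x * y` force `y` to fix the vertex fixed by `x`, as edge stabilizers are
trivial. In words: write `y = C R' E` with `C`, `E` spelled in `I` and `R'` beginning and ending
outside of `I`. If `E C ≠ 1`, the conjugate `R' (E C)` of `y` is not elliptic; if `E C = 1`, then
`C⁻¹ x C R'`, a conjugate of `x * y`, is not. -/
theorem mem_closure_of_elliptic_mul {I : Set ι} {x y : F} (hx1 : x ≠ 1)
    (hx : x ∈ Subgroup.closure (b '' I)) (hy : Elliptic b I y) (hxy : Elliptic b I (x * y)) :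
    y ∈ Subgroup.closure (b '' I) := by
  classical
  by_contra hyI
  set C := (word b y).takeWhile fun s => s.1 ∈ I
  set R := (word b y).dropWhile fun s => s.1 ∈ I
  set R' := R.rdropWhile fun s => s.1 ∈ I
  set E := R.rtakeWhile fun s => s.1 ∈ I
  have hCR : C ++ R = word b y := List.takeWhile_append_dropWhile
  have hRE : R' ++ E = R := List.rdropWhile_append_rtakeWhile
  have hC : ∀ s ∈ C, s.1 ∈ I := fun s hs => by simpa using List.mem_takeWhile_imp hs
  have hE : ∀ s ∈ E, s.1 ∈ I := fun s hs => by simpa using List.mem_rtakeWhile_imp hs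
  have hR : R ≠ [] := by
    intro h
    apply hyI
    rw [← eval_word b y, ← hCR, h, List.append_nil]
    exact mem_closure_of_forall_mem hC
  have hRhead : (R.head hR).1 ∉ I := by
    have := List.head_dropWhile_not (fun s : ι × Bool => decide (s.1 ∈ I)) (l := word b y) hR
    simpa using this
  have hR' : R' ≠ [] := by
    intro h
    rw [h, List.nil_append] at hRE
    refine hRhead (hE _ ?_)
    rw [hRE]
    exact List.head_mem hR
  have hR'head : R'.head? = some (R.head hR) := by
    rw [← List.head?_append_of_ne_nil R' hR' (l₂ := E), hRE, List.head?_eq_some_head hR]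
  have hR'last : (R'.getLast hR').1 ∉ I := by
    have := List.rdropWhile_last_not (fun s : ι × Bool => decide (s.1 ∈ I)) R hR'
    simpa using this
  have hRred : FreeGroup.IsReduced R' := by
    have h := isReduced_word b y
    rw [← hCR, ← hRE] at h
    exact h.infix ⟨C, E, by simp⟩
  set c := eval b C
  have hc : c ∈ Subgroup.closure (b '' I) := mem_closure_of_forall_mem hC
  set g := eval b E * c
  have hg : g ∈ Subgroup.closure (b '' I) := mul_mem (mem_closure_of_forall_mem hE) hc
  have hyc : c⁻¹ * y * c⁻¹⁻¹ = eval b R' * g := by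
    rw [← eval_word b y, ← hCR, ← hRE, eval_append, eval_append]
    simp only [g, c]
    group
  by_cases hg1 : g = 1
  · rw [hg1, mul_one] at hyc
    set x' := c⁻¹ * x * c⁻¹⁻¹
    have hx'1 : x' ≠ 1 := mt conj_eq_one_iff.1 hx1
    have hx' : x' ∈ Subgroup.closure (b '' I) := mul_mem (mul_mem (inv_mem hc) hx) (by simpa using hc)
    have hw : word b x' ≠ [] := mt (word_eq_nil b).1 hx'1
    have hwI := forall_mem_word_of_mem_closure hx'
    have h1 : eval b (word b x' ++ R') = c⁻¹ * (x * y) * c⁻¹⁻¹ := by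
      rw [eval_append, eval_word, ← hyc]
      simp only [x']
      group
    refine not_elliptic_eval (b := b) (I := I) (L := word b x' ++ R')
      (isReduced_append_of_ne (isReduced_word b x') hRred fun s hs t ht he => ?_)
      (s := (word b x').head hw) (t := R'.getLast hR') ?_ ?_ (hwI _ (List.head_mem hw)) hR'last ?_
    · rw [hR'head] at ht
      obtain rfl := Option.some.inj ht
      exact hRhead (he ▸ hwI s (List.mem_of_getLast? hs))
    · rw [List.head?_append_of_ne_nil _ hw, List.head?_eq_some_head hw]
    · rw [List.getLast?_append_of_ne_nil _ hR', List.getLast?_eq_some_getLast hR']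
    · rw [h1]
      exact hxy.conj _
  · have hw : word b g ≠ [] := mt (word_eq_nil b).1 hg1
    have hwI := forall_mem_word_of_mem_closure hg
    refine not_elliptic_eval (b := b) (I := Iᶜ) (L := R' ++ word b g)
      (isReduced_append_of_ne hRred (isReduced_word b g) fun s hs t ht he => ?_)
      (s := R.head hR) (t := (word b g).getLast hw) ?_ ?_ hRhead
      (fun h => h (hwI _ (List.getLast_mem hw))) ?_
    · rw [List.getLast?_eq_some_getLast hR'] at hs
      obtain rfl := Option.some.inj hs
      exact hR'last (he ▸ hwI t (List.mem_of_head? ht))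
    · rw [List.head?_append_of_ne_nil _ hR', hR'head]
    · rw [List.getLast?_append_of_ne_nil _ hw, List.getLast?_eq_some_getLast hw]
    · rw [elliptic_compl, eval_append, eval_word, ← hyc]
      exact hy.conj _

/-- A subgroup is conjugate into one of the two free factors if its generators and the products of
two generators are. -/
theorem exists_conj_le_of_elliptic {I : Set ι} {T : Set F} (hT : Subgroup.closure T ≠ ⊥)
    (h1 : ∀ y ∈ T, Elliptic b I y) (h2 : ∀ x ∈ T, ∀ y ∈ T, Elliptic b I (x * y)) :
    ∃ c, (∀ x ∈ Subgroup.closure T, c * x * c⁻¹ ∈ Subgroup.closure (b '' I)) ∨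
      ∀ x ∈ Subgroup.closure T, c * x * c⁻¹ ∈ Subgroup.closure (b '' Iᶜ) := by
  obtain ⟨x, hx, hx1⟩ : ∃ x ∈ T, x ≠ 1 := by
    by_contra! h
    exact hT (Subgroup.closure_eq_bot_iff.2 fun x hx => h x hx)
  -- A single non-trivial generator `x` determines the factor and the conjugator for all the others.
  have key : ∀ (J : Set ι) (c : F), (∀ y ∈ T, Elliptic b J y) →
      (∀ y ∈ T, Elliptic b J (x * y)) → c * x * c⁻¹ ∈ Subgroup.closure (b '' J) →
      ∀ y ∈ Subgroup.closure T, c * y * c⁻¹ ∈ Subgroup.closure (b '' J) := by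
    intro J c hT1 hT2 hc
    have : Subgroup.closure T ≤ (Subgroup.closure (b '' J)).comap (MulAut.conj c).toMonoidHom := by
      rw [Subgroup.closure_le]
      intro y hy
      refine mem_closure_of_elliptic_mul (x := c * x * c⁻¹) (by simpa using hx1) hc
        ((hT1 y hy).conj c) ?_
      have e : c * x * c⁻¹ * (MulAut.conj c).toMonoidHom y = c * (x * y) * c⁻¹ := by
        change c * x * c⁻¹ * (c * y * c⁻¹) = _
        group
      rw [e]
      exact (hT2 y hy).conj c
    exact fun y hy => this hy
  obtain ⟨c, hc | hc⟩ := h1 x hx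
  · exact ⟨c, Or.inl (key I c h1 (h2 x hx) hc)⟩
  · exact ⟨c, Or.inr (key Iᶜ c (fun y hy => elliptic_compl.2 (h1 y hy))
      (fun y hy => elliptic_compl.2 (h2 x hx y hy)) hc)⟩

end Splitting

/-! ### Separability is detected by relative currents -/

section Main

variable {F ι : Type*} [Group F]

theorem FreeFactorSystem.IsNontrivial.ne_one {A : FreeFactorSystem F} (hA : A.IsNontrivial) {a : F}
    (ha : ¬ A.Carries a) : a ≠ 1 := by
  rintro rfl
  exact ha ⟨⟨0, Nat.pos_of_ne_zero hA.1⟩, 1, by simp⟩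

theorem FreeFactorSystem.Carries.inv {A : FreeFactorSystem F} {a : F} (h : A.Carries a) :
    A.Carries a⁻¹ := by
  obtain ⟨i, g, h⟩ := h
  refine ⟨i, g, ?_⟩
  rw [← conj_inv]
  exact inv_mem h

theorem ne_zero_of_toFun_ne_zero {b : FreeGroupBasis ι F} {A : FreeFactorSystem F}
    {η : RelCurrent b A} {C : TopologicalSpace.CompactOpens (Y b A)} (h : η.toFun C ≠ 0) :
    η ≠ 0 := by
  rintro rfl
  exact h rfl

/-- Being non-zero on `C` is an open condition on currents and is unaffected by scaling, so it
descends to the quotient. -/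
theorem exists_isOpen_toFun_ne_zero {b : FreeGroupBasis ι F} {A : FreeFactorSystem F}
    (C : TopologicalSpace.CompactOpens (Y b A)) :
    ∃ O : Set (ProjRelCurrent b A), IsOpen O ∧
      ∀ (η : RelCurrent b A) (h : η ≠ 0), projClass η h ∈ O ↔ η.toFun C ≠ 0 := by
  let O : Set (ProjRelCurrent b A) :=
    Quotient.mk (projSetoid b A) '' {η | η.1.toFun C ≠ 0}
  have hO : ∀ η : {η : RelCurrent b A // η ≠ 0},
      Quotient.mk (projSetoid b A) η ∈ O ↔ η.1.toFun C ≠ 0 := by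
    refine fun η => ⟨?_, fun h => ⟨η, h, rfl⟩⟩
    rintro ⟨θ, hθ, he⟩
    obtain ⟨c, hc, h⟩ : (projSetoid b A).r θ η := Quotient.exact he
    rw [h]
    exact mul_ne_zero hc.ne' hθ
  refine ⟨O, ?_, fun η h => hO ⟨η, h⟩⟩
  have hpre : IsOpen (Quotient.mk (projSetoid b A) ⁻¹' O) := by
    have e : Quotient.mk (projSetoid b A) ⁻¹' O = {η | η.1.toFun C ≠ 0} := by
      ext η
      exact hO η
    rw [e]
    have hcont : Continuous fun η : {η : RelCurrent b A // η ≠ 0} => η.1.toFun C :=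
      (continuous_apply C).comp (continuous_induced_dom.comp continuous_subtype_val)
    exact isOpen_ne.preimage hcont
  exact hpre

theorem isSeparable_of_elliptic {b : FreeGroupBasis ι F} {A : FreeFactorSystem F} {a : F}
    {I : Set ι} (hI : I.Nonempty) (hI' : Iᶜ.Nonempty) (ha : Elliptic b I a)
    (hA : ∀ i, ∃ c, (∀ x ∈ A.factor i, c * x * c⁻¹ ∈ Subgroup.closure (b '' I)) ∨
      ∀ x ∈ A.factor i, c * x * c⁻¹ ∈ Subgroup.closure (b '' Iᶜ)) : A.IsSeparable a := by
  classical
  let κ : ι → Fin 2 := fun i => if i ∈ I then 0 else 1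
  have hκ : Function.Surjective κ := by
    intro j
    fin_cases j
    · exact ⟨hI.some, if_pos hI.some_mem⟩
    · exact ⟨hI'.some, if_neg hI'.some_mem⟩
  have h0 : κ ⁻¹' {0} = I := by ext i; simp [κ]
  have h1 : κ ⁻¹' {1} = Iᶜ := by ext i; simp [κ]
  have e0 : (FreeFactorSystem.ofColoring b κ hκ).factor (0 : Fin 2) = Subgroup.closure (b '' I) := by
    rw [← h0]; rfl
  have e1 : (FreeFactorSystem.ofColoring b κ hκ).factor (1 : Fin 2) =
      Subgroup.closure (b '' Iᶜ) := by
    rw [← h1]; rfl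
  refine ⟨FreeFactorSystem.ofColoring b κ hκ, FreeFactorSystem.ofColoring_isNontrivial hκ,
    fun i => ?_, ?_⟩
  · obtain ⟨c, hc | hc⟩ := hA i
    · exact ⟨(0 : Fin 2), c, fun x hx => e0 ▸ hc x hx⟩
    · exact ⟨(1 : Fin 2), c, fun x hx => e1 ▸ hc x hx⟩
  · obtain ⟨c, hc | hc⟩ := ha
    · exact ⟨(0 : Fin 2), c, e0 ▸ hc⟩
    · exact ⟨(1 : Fin 2), c, e1 ▸ hc⟩

/-- If `a` is not `A`-separable, then in a suitable basis the Whitehead graph of `a` together with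
finitely many elements of the factors of `A` is connected without cut vertex. -/
theorem exists_basis_noCutVertex [Finite ι] (b : FreeGroupBasis ι F) (A : FreeFactorSystem F)
    {a : F} (ha1 : a ≠ 1) (ha : ¬ A.IsSeparable a) :
    ∃ (b' : FreeGroupBasis ι F) (S : Set F), NoCutVertex (Joined b' S) ∧
      ∀ y ∈ S, y = a ∨ y = a⁻¹ ∨ ∃ i, y ∈ A.factor i := by
  classical
  choose T hTfin hT using fun i => A.exists_generators b i
  have hTA : ∀ i, ∀ x ∈ T i, x ∈ A.factor i := fun i x hx => hT i ▸ Subgroup.subset_closure hx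
  -- The products of two generators are included so that ellipticity of `W` passes to the whole
  -- factors, by `exists_conj_le_of_elliptic`.
  let W : Set F := {a} ∪ ⋃ i, (T i ∪ T i * T i)
  have hW : W.Finite := (finite_singleton a).union
    (finite_iUnion fun i => (hTfin i).union ((hTfin i).mul (hTfin i)))
  have hWA : ∀ y ∈ W, y = a ∨ ∃ i, y ∈ A.factor i := by
    rintro y (hy | hy)
    · exact Or.inl hy
    · obtain ⟨i, hy | ⟨x, hx, z, hz, rfl⟩⟩ := mem_iUnion.1 hy
      · exact Or.inr ⟨i, hTA i y hy⟩
      · exact Or.inr ⟨i, mul_mem (hTA i x hx) (hTA i z hz)⟩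
  have hSfin : ((W ∪ W⁻¹) \ {1}).Finite := (hW.union hW.inv).subset sdiff_subset
  let S : Finset F := hSfin.toFinset
  have hS : ∀ y, y ∈ S ↔ (y ∈ W ∨ y⁻¹ ∈ W) ∧ y ≠ 1 := fun y => by simp [S]
  obtain ⟨b', hopt⟩ := exists_isOptimal b S
  rcases hopt.noCutVertex_or ⟨a, (hS a).2 ⟨Or.inl (Or.inl rfl), ha1⟩⟩
    (fun y hy => ((hS y).1 hy).2)
    (fun y hy => (hS y⁻¹).2 ⟨by rw [inv_inv]; exact ((hS y).1 hy).1.symm,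
      inv_ne_one.2 ((hS y).1 hy).2⟩) with h | ⟨I, hI, hI', h⟩
  · refine ⟨b', S, h, fun y hy => ?_⟩
    rcases ((hS y).1 hy).1 with h | h
    · exact (hWA y h).imp id Or.inr
    · rcases hWA _ h with h | ⟨i, h⟩
      · exact Or.inr (Or.inl (by rw [← h, inv_inv]))
      · exact Or.inr (Or.inr ⟨i, by simpa using h⟩)
  · have hell : ∀ y ∈ W, Elliptic b' I y := by
      intro y hy
      by_cases hy1 : y = 1
      · exact hy1 ▸ elliptic_one I
      · exact h y ((hS y).2 ⟨Or.inl hy, hy1⟩)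
    refine (ha (isSeparable_of_elliptic hI hI' (hell a (Or.inl rfl)) fun i => ?_)).elim
    have := exists_conj_le_of_elliptic (b := b') (I := I) (T := T i)
      (by rw [hT]; exact A.factor_ne_bot i)
      (fun y hy => hell y (Or.inr (mem_iUnion.2 ⟨i, Or.inl hy⟩)))
      (fun x hx y hy => hell _ (Or.inr (mem_iUnion.2 ⟨i, Or.inr ⟨x, hx, y, hy, rfl⟩⟩)))
    rwa [hT] at this

theorem isSeparable_of_mem_MRC [Finite ι] (b : FreeGroupBasis ι F) (A : FreeFactorSystem F)
    (hA : A.IsNontrivial) {a : F} (ha : ¬ A.Carries a) (h : rationalCurrent b A a ≠ 0)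
    (hmem : projClass (rationalCurrent b A a) h ∈ MRC b A) : A.IsSeparable a := by
  by_contra hsep
  have := isMulTorsionFree_of_basis b
  have ha1 := hA.ne_one ha
  obtain ⟨b', S, hS, hSA⟩ := exists_basis_noCutVertex b A ha1 hsep
  have hdisj : ∀ p q, p ≠ q → Disjoint (half b' p) (half b' q) := fun p q hpq =>
    disjoint_left.2 fun x hx hx' => hpq (half_disjoint b' hx hx')
  -- The edges that `a` contributes and no element of a factor of `A` does. Only these define
  -- compact open subsets of `Y`; the other edges need no help from `v`.
  let Q : Set ((ι × Bool) × (ι × Bool)) := {e | e.1 ≠ e.2 ∧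
    Connects a (half b' e.1) (half b' e.2) ∧
    ∀ i, ∀ x ∈ A.factor i, ¬ Connects x (half b' e.1) (half b' e.2)}
  choose C hC using fun e : Q => exists_compactOpens (b := b) A (almostInvariant_half b' e.1.1)
    (almostInvariant_half b' e.1.2) (hdisj _ _ e.2.1) e.2.2.2
  choose O hO hO' using fun e : Q => exists_isOpen_toFun_ne_zero (C e)
  -- There are finitely many letters, so the intersection is open; it contains `[η_a]` and hence
  -- some separable `[η_v]`.
  obtain ⟨_, hvO, v, hv, hvA, ⟨D, hD, hAD, hDv⟩, rfl⟩ := mem_closure_iff.1 hmem (⋂ e, O e)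
    (isOpen_iInter_of_finite hO)
    (mem_iInter.2 fun e => (hO' e _ h).2 ((hC e a ha1).2 (Or.inl e.2.2.1)))
  have hv1 := hA.ne_one hvA
  have hvQ : ∀ e : Q, Connects v (half b' e.1.1) (half b' e.1.2) ∨
      Connects v (half b' e.1.2) (half b' e.1.1) := fun e =>
    (hC e v hv1).1 ((hO' e _ hv).1 (mem_iInter.1 hvO e))
  obtain ⟨X, hXai, hX1, hX2, hX⟩ := D.exists_almostInvariant hD
  let T : Set F := {v} ∪ ⋃ i, (A.factor i : Set F)
  have hTD : ∀ y ∈ T, D.Carries y := by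
    rintro y (rfl | hy)
    · exact hDv
    · obtain ⟨i, hi⟩ := mem_iUnion.1 hy
      obtain ⟨j, g, hg⟩ := hAD i
      exact ⟨j, g, hg y hi⟩
  have hfactor : ∀ i, ∀ x ∈ A.factor i, x ∈ T := fun i x hx => Or.inr (mem_iUnion.2 ⟨i, hx⟩)
  have hjoin : ∀ p q, p ≠ q → Connects a (half b' p) (half b' q) → Joined b' T p q := by
    intro p q hpq hconn
    by_cases hno : ∀ i, ∀ x ∈ A.factor i, ¬ Connects x (half b' p) (half b' q)
    · exact ⟨v, Or.inl rfl, hv1, hvQ ⟨(p, q), hpq, hconn, hno⟩⟩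
    · push Not at hno
      obtain ⟨i, x, hx, hxc⟩ := hno
      refine ⟨x, hfactor i x hx, ?_, Or.inl hxc⟩
      rintro rfl
      obtain ⟨g, h1, h2⟩ := hxc
      rw [inv_one] at h2
      obtain ⟨z, hz⟩ := (h1.inter h2).nonempty
      exact disjoint_left.1 (hdisj p q hpq) hz.1 hz.2
  have hjoin_symm : ∀ p q, Joined b' T p q → Joined b' T q p := by
    rintro p q ⟨y, h1, h2, h3⟩
    exact ⟨y, h1, h2, h3.symm⟩
  -- Replacing `a` by `v` and adding all elements of the factors loses no edge of the graph.
  have hT : NoCutVertex (Joined b' T) := by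
    refine hS.mono ?_
    rintro p q hpq ⟨y, hy, hy1, hc⟩
    rcases hSA y hy with rfl | rfl | ⟨i, hi⟩
    · exact hc.elim (hjoin p q hpq) fun h => hjoin_symm _ _ (hjoin q p hpq.symm h)
    · refine hc.elim (fun h => hjoin_symm _ _ (hjoin q p hpq.symm ?_)) fun h => hjoin p q hpq ?_
      · simpa using h.symm
      · simpa using h.symm
    · exact ⟨y, hfactor i y hi, hy1, hc⟩
  refine (finite_or_finite_of_noCutVertex hXai (fun y hy hy1 => ⟨hX y hy1 (hTD y hy), fun hc => ?_⟩)
    hT).elim hX1 hX2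
  exact hX y⁻¹ (inv_ne_one.2 hy1) (hTD y hy).inv hc.symm

end Main

end RelCurrents

end

theorem mainTheorem8 {F ι : Type*} [Group F] [Finite ι] (b : FreeGroupBasis ι F)
    (A : RelCurrents.FreeFactorSystem F) (hA : A.IsNontrivial) (hζ : 3 ≤ A.zeta)
    (a : F) (ha : ¬ A.Carries a) :
    ∃ h : RelCurrents.rationalCurrent b A a ≠ 0,
      (RelCurrents.projClass (RelCurrents.rationalCurrent b A a) h ∈ RelCurrents.MRC b A ↔
        A.IsSeparable a) := by
  have ha1 := hA.ne_one ha
  obtain ⟨U, V, hU, hV, hUV, hconn, hno⟩ := RelCurrents.exists_separating_sets b A ha1 ha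
  obtain ⟨C, hC⟩ := RelCurrents.exists_compactOpens (b := b) A hU hV hUV hno
  have h := RelCurrents.ne_zero_of_toFun_ne_zero ((hC a ha1).2 (Or.inl hconn))
  exact ⟨h, RelCurrents.isSeparable_of_mem_MRC b A hA ha h,
    fun hsep => subset_closure ⟨a, h, ha, hsep, rfl⟩⟩
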